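/- Let $n,k,d$ be integers with $1\le k\le n$ and $0\le d\le n$. The reflection arrangement of type $B_n$ consists of the hyperplanes $\{\beta_i=\beta_j\}$, $\{\beta_i=-\beta_j\}$ $(1\le i<j\le n)$ and $\{\beta_i=0\}$ $(1\le i\le n)$ in $\mathbb R^n$. Let $L\subset\mathbb R^n$ be a linear subspace of codimension $d$ in general position with respect to this arrangement, meaning that for every linear subspace $K$ that is an intersection of hyperplanes of the arrangement (the empty intersection being $\mathbb R^n$), $\dim(L\cap K)=\dim K-d$ if $\dim K\ge d$, and $\dim(L\cap K)=0$ if $\dim K\le d$. For $\varepsilon\in\{-1,+1\}^n$ and a permutation $\sigma$ of $\{1,\dots,n\}$ let $$C_{\varepsilon,\sigma}^B=\{\beta\in\mathbb R^n:\ \varepsilon_1\beta_{\sigma(1)}\ge\varepsilon_2\beta_{\sigma(2)}\ge\dots\ge\varepsilon_n\beta_{\sigma(n)}\ge 0\}$$ be the closed Weyl chambers of type $B_n$, and let $\mathcal F_k(C)$ denote the set of $k$-dimensional faces of a polyhedral cone $C$. Then $$\frac1{2^n n!}\sum_{\varepsilon\in\{-1,+1\}^n}\ \sum_{\sigma\in\mathrm{Sym}(n)}\#\{F\in\mathcal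 F_k(C_{\varepsilon,\sigma}^B):\ F\cap L=\{0\}\}=2\binom nk\frac{B(k,d-1)+B(k,d-3)+\dots}{2^k k!},$$ where the numbers $B(k,j)$ are defined by $(t+1)(t+3)\cdots(t+2k-1)=\sum_{j=0}^k B(k,j)t^j$ and $B(k,j)=0$ for $j<0$ and $j>k$. -/

import Mathlib

noncomputable section

namespace WeylB

/-- The hyperplanes `{β_i = β_j}`, `{β_i = -β_j}` (`i < j`) and `{β_i = 0}` of the reflection
arrangement of type `B_n`. -/
def reflectionArrangement (n : ℕ) : Set (Submodule ℝ (Fin n → ℝ)) :=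
  {H | (∃ i j : Fin n, i < j ∧
          H = LinearMap.ker (LinearMap.proj (R := ℝ) (φ := fun _ : Fin n => ℝ) i
            - LinearMap.proj j)) ∨
       (∃ i j : Fin n, i < j ∧
          H = LinearMap.ker (LinearMap.proj (R := ℝ) (φ := fun _ : Fin n => ℝ) i
            + LinearMap.proj j)) ∨
       (∃ i : Fin n, H = LinearMap.ker (LinearMap.proj (R := ℝ) (φ := fun _ : Fin n => ℝ) i))}

/-- The lattice generated by the reflection arrangement: all intersections of its hyperplanes
(the empty intersection is the whole space). -/
def arrangementLattice (n : ℕ) : Set (Submodule ℝ (Fin n → ℝ)) :=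
  {K | ∃ S ⊆ reflectionArrangement n, K = sInf S}

/-- `L`, of codimension `d`, is in general position with respect to the reflection arrangement. -/
def InGeneralPosition {n : ℕ} (L : Submodule ℝ (Fin n → ℝ)) (d : ℕ) : Prop :=
  ∀ K ∈ arrangementLattice n,
    (d ≤ Module.finrank ℝ K → (Module.finrank ℝ ↥(L ⊓ K) : ℤ) = (Module.finrank ℝ K : ℤ) - d) ∧
    (Module.finrank ℝ K ≤ d → Module.finrank ℝ ↥(L ⊓ K) = 0)

/-- The closed Weyl chamber
`{β : ε₁ β_{σ(1)} ≥ ε₂ β_{σ(2)} ≥ … ≥ ε_n β_{σ(n)} ≥ 0}` of type `B_n`, as a convex cone.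
The signs `ε_i ∈ {-1, +1}` are the units of `ℤ`. -/
def chamber {n : ℕ} (ε : Fin n → ℤˣ) (σ : Equiv.Perm (Fin n)) : PointedCone ℝ (Fin n → ℝ) where
  carrier := {β | (∀ i j : Fin n, i ≤ j →
      ((ε j : ℤ) : ℝ) * β (σ j) ≤ ((ε i : ℤ) : ℝ) * β (σ i)) ∧
    ∀ i : Fin n, 0 ≤ ((ε i : ℤ) : ℝ) * β (σ i)}
  add_mem' := by
    rintro x y ⟨hx, hx'⟩ ⟨hy, hy'⟩
    refine ⟨fun i j hij => ?_, fun i => ?_⟩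
    · have h1 := hx i j hij
      have h2 := hy i j hij
      simp only [Pi.add_apply, mul_add]
      linarith
    · have h1 := hx' i
      have h2 := hy' i
      simp only [Pi.add_apply, mul_add]
      linarith
  zero_mem' := by simp
  smul_mem' := by
    rintro ⟨c, hc⟩ x ⟨hx, hx'⟩
    refine ⟨fun i j hij => ?_, fun i => ?_⟩
    · have h := mul_le_mul_of_nonneg_left (hx i j hij) hc
      simpa [NNReal.smul_def, mul_left_comm] using h
    · have h := mul_nonneg hc (hx' i)
      simpa [NNReal.smul_def, mul_left_comm] using h

/-- The set of `k`-dimensional faces of a convex cone; the dimension of a face is the dimension of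
its linear hull. -/
def faces {n : ℕ} (k : ℕ) (Q : PointedCone ℝ (Fin n → ℝ)) : Set (PointedCone ℝ (Fin n → ℝ)) :=
  {F | F.IsFaceOf Q ∧ Module.finrank ℝ (Submodule.span ℝ (F : Set (Fin n → ℝ))) = k}

/-- A polyhedral cone has finitely many faces. -/
theorem finite_isFaceOf {n : ℕ} {ι : Type} [Finite ι] (f : ι → (Fin n → ℝ) →ₗ[ℝ] ℝ)
    (Q : PointedCone ℝ (Fin n → ℝ)) (hQ : ∀ x, x ∈ Q ↔ ∀ i, 0 ≤ f i x) :
    {F : PointedCone ℝ (Fin n → ℝ) | F.IsFaceOf Q}.Finite := by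
  classical
  cases nonempty_fintype ι
  have key : ∀ F₁ F₂ : PointedCone ℝ (Fin n → ℝ), F₁.IsFaceOf Q → F₂.IsFaceOf Q →
      {i | ∀ x ∈ F₁, f i x = 0} = {i | ∀ x ∈ F₂, f i x = 0} → F₁ ≤ F₂ := by
    intro F₁ F₂ h₁ h₂ h y hy
    have hyQ := h₁.le hy
    have hch : ∀ i, ∃ x ∈ F₂, f i y ≠ 0 → 0 < f i x := by
      intro i
      by_cases hi : f i y = 0
      · exact ⟨0, F₂.zero_mem, fun h => absurd hi h⟩
      · have : i ∉ {i | ∀ x ∈ F₂, f i x = 0} := by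
          rw [← h]
          exact fun hc => hi (hc y hy)
        simp only [Set.mem_ofPred_eq, not_forall] at this
        obtain ⟨x, hx, hne⟩ := this
        exact ⟨x, hx, fun _ => lt_of_le_of_ne ((hQ x).1 (h₂.le hx) i) (Ne.symm hne)⟩
    choose x hx hpos using hch
    have hzF : ∑ i, x i ∈ F₂ := Submodule.sum_mem _ fun i _ => hx i
    have hz : ∀ i, f i (x i) ≤ f i (∑ j, x j) := by
      intro i
      rw [map_sum]
      exact Finset.single_le_sum (f := fun j => f i (x j))
        (fun j _ => (hQ _).1 (h₂.le (hx j)) i) (Finset.mem_univ i)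
    have hev : ∀ᶠ c : ℝ in nhdsWithin 0 (Set.Ioi 0), ∀ i, 0 ≤ f i (∑ j, x j) - c * f i y := by
      rw [Filter.eventually_all]
      intro i
      by_cases hi : f i y = 0
      · simp only [hi, mul_zero, sub_zero]
        exact Filter.Eventually.of_forall fun _ => (hQ _).1 (h₂.le hzF) i
      · have h0 : 0 < f i (∑ j, x j) := lt_of_lt_of_le (hpos i hi) (hz i)
        have ht : Filter.Tendsto (fun c : ℝ => f i (∑ j, x j) - c * f i y)
            (nhdsWithin 0 (Set.Ioi 0)) (nhds (f i (∑ j, x j) - 0 * f i y)) :=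
          (Continuous.tendsto (by fun_prop) 0).mono_left nhdsWithin_le_nhds
        rw [zero_mul, sub_zero] at ht
        filter_upwards [ht.eventually (lt_mem_nhds h0)] with c hc using hc.le
    obtain ⟨c, hc, hc0⟩ := (hev.and self_mem_nhdsWithin).exists
    have hc0' : (0 : ℝ) < c := hc0
    refine h₂.mem_of_smul_add_mem (y := ∑ j, x j - c • y) hyQ ?_ hc0' ?_
    · rw [hQ]
      intro i
      simpa using hc i
    · simpa using hzF
  refine Set.Finite.of_finite_image (f := fun F : PointedCone ℝ (Fin n → ℝ) =>
    {i | ∀ x ∈ F, f i x = 0}) (Set.toFinite _) ?_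
  intro F₁ h₁ F₂ h₂ h
  exact le_antisymm (key _ _ h₁ h₂ h) (key _ _ h₂ h₁ h.symm)

/-- The set of `k`-faces of a Weyl chamber is finite, so that counting them by `Set.ncard` is
meaningful. -/
theorem finite_faces_chamber {n : ℕ} (k : ℕ) (ε : Fin n → ℤˣ) (σ : Equiv.Perm (Fin n)) :
    (faces k (chamber ε σ)).Finite := by
  let g : Fin n → (Fin n → ℝ) →ₗ[ℝ] ℝ := fun i => ((ε i : ℤ) : ℝ) • LinearMap.proj (σ i)
  refine (finite_isFaceOf (ι := {p : Fin n × Fin n // p.1 ≤ p.2} ⊕ Fin n)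
    (Sum.elim (fun p => g p.1.1 - g p.1.2) g) (chamber ε σ) ?_).subset fun F hF => hF.1
  intro x
  change (_ ∧ _) ↔ _
  simp [g, Sum.forall]

/-- The number of `k`-dimensional faces `F` of the cone `Q` with `F ∩ L = {0}`. -/
def numTrivialFaces {n : ℕ} (k : ℕ) (L : Submodule ℝ (Fin n → ℝ))
    (Q : PointedCone ℝ (Fin n → ℝ)) : ℕ :=
  {F ∈ faces k Q | (F : Set (Fin n → ℝ)) ∩ (L : Set (Fin n → ℝ)) = {0}}.ncard

/-- The coefficients `B(k, j)` given by `(t+1)(t+3)⋯(t+2k-1) = ∑_j B(k, j) t^j`, with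
`B(k, j) = 0` for `j < 0` (and automatically for `j > k`). -/
def B (k : ℕ) (j : ℤ) : ℕ :=
  if 0 ≤ j then
    (∏ i ∈ Finset.range k,
      ((Polynomial.X : Polynomial ℕ) + Polynomial.C (2 * i + 1))).coeff j.toNat
  else 0

end WeylB

end

/-!
Let `m(L)` be the number of Weyl chambers of `ℝᵏ` whose interior meets `L`. Deleting, one by one,
the `2k + 1` hyperplanes of the arrangement in `ℝᵏ⁺¹` which involve the last coordinate expresses
`m(L)` through `m` of the projection of `L` to `ℝᵏ` (codimension `d - 1`) and `m` of the
restrictions of `L` to these hyperplanes (codimension `d`). This is the recursion of the `B(k, j)`,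
so `m(L) = 2ᵏ k! - 2 (B(k, d - 1) + B(k, d - 3) + ⋯)`. By general position, the remaining chambers
meet `L` only in `0`: were `x ≠ 0` a common point, `L` and the smallest flat containing `x` would
span `ℝᵏ`, and `x` could be moved inside `L` to the interior of the chamber.

A `k`-face of a chamber of `ℝⁿ` is the image of the fundamental chamber of `ℝᵏ` under a map `spread`
which copies the `k` coordinates, up to sign, onto `k` blocks of the `n` coordinates and fills up
with zeros. Permuting the blocks and changing their signs permutes the faces of all chambers, so the
fundamental chamber may be replaced by the average over the `2ᵏ k!` chambers of `ℝᵏ`. After this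
averaging every block map contributes the chamber count for the pullback of `L` to `ℝᵏ`, which is
again in general position.
-/

noncomputable section

namespace WeylB

open Module Filter Topology

/-- The `o`-th coordinate functional of `ℝᵏ`, with the convention that the coordinate of the extra
index `Fin.last k` is `0`; this treats the hyperplanes `β_i = 0` on a par with `β_i = β_j`. -/
def coord {k : ℕ} (o : Fin (k + 1)) : Dual ℝ (Fin k → ℝ) :=
  Fin.lastCases 0 (fun c => LinearMap.proj c) o

@[simp] theorem coord_last {k : ℕ} : coord (Fin.last k) = 0 := Fin.lastCases_last

@[simp] theorem coord_castSucc {k : ℕ} (c : Fin k) : coord c.castSucc = LinearMap.proj c :=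
  Fin.lastCases_castSucc c

/-- The linear forms `±β_o ∓ β_o'` cutting out the reflection arrangement. -/
def rootForm {k : ℕ} (t : ℤˣ) (o o' : Fin (k + 1)) : Dual ℝ (Fin k → ℝ) :=
  coord o - t • coord o'

theorem rootForm_apply {k : ℕ} (t : ℤˣ) (o o' : Fin (k + 1)) (x : Fin k → ℝ) :
    rootForm t o o' x = coord o x - t • coord o' x := rfl

theorem rootForm_comm {k : ℕ} (t : ℤˣ) (o o' : Fin (k + 1)) :
    rootForm t o' o = -t • rootForm t o o' := by
  rw [rootForm, rootForm, smul_sub, smul_smul, neg_mul, Int.units_mul_self, Units.neg_smul,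
    Units.neg_smul, one_smul, sub_neg_eq_add, neg_add_eq_sub]

/-- The linear forms defining the hyperplanes of the reflection arrangement, one for each
hyperplane. -/
def forms (k : ℕ) : Set (Dual ℝ (Fin k → ℝ)) :=
  {l | ∃ t o o', o < o' ∧ l = rootForm t o o'}

theorem finite_forms (k : ℕ) : (forms k).Finite := by
  refine (Set.finite_range fun p : ℤˣ × Fin (k + 1) × Fin (k + 1) =>
    rootForm p.1 p.2.1 p.2.2).subset ?_
  rintro _ ⟨t, o, o', -, rfl⟩
  exact ⟨(t, o, o'), rfl⟩

theorem exists_smul_rootForm_mem_forms {k : ℕ} (t : ℤˣ) {o o' : Fin (k + 1)} (h : o ≠ o') :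
    ∃ u : ℤˣ, u • rootForm t o o' ∈ forms k := by
  rcases h.lt_or_gt with h | h
  · exact ⟨1, t, o, o', h, one_smul _ _⟩
  · exact ⟨-t, t, o', o, h, (rootForm_comm t o o').symm⟩

theorem exists_rootForm_eq_smul {k : ℕ} {t : ℤˣ} {o o' : Fin (k + 1)}
    (h : o ≠ o' ∨ t = -1 ∧ o ≠ Fin.last k) :
    ∃ m ∈ forms k, ∃ c : ℝ, c ≠ 0 ∧ rootForm t o o' = c • m := by
  by_cases hoo' : o = o'
  · subst hoo'
    obtain ⟨rfl, ho⟩ := h.resolve_left (not_not.2 rfl)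
    refine ⟨_, ⟨1, o, _, Fin.lt_last_iff_ne_last.2 ho, rfl⟩, 2, two_ne_zero, ?_⟩
    rw [rootForm, rootForm, coord_last, Units.neg_smul, one_smul, smul_zero, sub_zero,
      sub_neg_eq_add, two_smul]
  · obtain ⟨u, hu⟩ := exists_smul_rootForm_mem_forms t hoo'
    refine ⟨_, hu, ((u : ℤ) : ℝ), Int.cast_ne_zero.2 u.ne_zero, ?_⟩
    rcases Int.units_eq_one_or u with rfl | rfl <;> simp

theorem ne_zero_of_mem_forms {k : ℕ} {l : Dual ℝ (Fin k → ℝ)} (hl : l ∈ forms k) : l ≠ 0 := by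
  obtain ⟨t, o, o', h, rfl⟩ := hl
  obtain ⟨i, rfl⟩ := Fin.exists_castSucc_eq.2 (Fin.ne_last_of_lt h)
  have hval : rootForm t i.castSucc o' (Pi.single i 1) = 1 := by
    rw [rootForm_apply, coord_castSucc]
    cases o' using Fin.lastCases with
    | last => simp
    | cast j => simp [(Fin.castSucc_lt_castSucc_iff.1 h).ne']
  rintro h0
  simp [h0] at hval

theorem reflectionArrangement_eq_image_ker (n : ℕ) :
    reflectionArrangement n = LinearMap.ker '' forms n := by
  refine Set.Subset.antisymm ?_ ?_
  · rintro _ (⟨i, j, hij, rfl⟩ | ⟨i, j, hij, rfl⟩ | ⟨i, rfl⟩)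
    · exact ⟨_, ⟨1, i.castSucc, j.castSucc, Fin.castSucc_lt_castSucc_iff.2 hij, rfl⟩, by
        simp [rootForm]⟩
    · exact ⟨_, ⟨-1, i.castSucc, j.castSucc, Fin.castSucc_lt_castSucc_iff.2 hij, rfl⟩, by
        simp [rootForm, Units.smul_def]⟩
    · exact ⟨_, ⟨1, i.castSucc, Fin.last n, Fin.castSucc_lt_last i, rfl⟩, by simp [rootForm]⟩
  · rintro _ ⟨_, ⟨t, o, o', h, rfl⟩, rfl⟩
    obtain ⟨i, rfl⟩ := Fin.exists_castSucc_eq.2 (Fin.ne_last_of_lt h)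
    cases o' using Fin.lastCases with
    | last => exact Or.inr (Or.inr ⟨i, by simp [rootForm]⟩)
    | cast j =>
      have hij := Fin.castSucc_lt_castSucc_iff.1 h
      rcases Int.units_eq_one_or t with rfl | rfl
      · exact Or.inl ⟨i, j, hij, by simp [rootForm]⟩
      · exact Or.inr (Or.inl ⟨i, j, hij, by simp [rootForm, Units.smul_def]⟩)

theorem iInf_mem_arrangementLattice {n : ℕ} {ι : Sort*} {K : ι → Submodule ℝ (Fin n → ℝ)}
    (h : ∀ i, K i ∈ arrangementLattice n) : ⨅ i, K i ∈ arrangementLattice n := by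
  choose S hS hK using h
  refine ⟨⋃ i, S i, Set.iUnion_subset hS, ?_⟩
  simp_rw [hK, sInf_eq_iInf, iInf_iUnion]

theorem top_mem_arrangementLattice (n : ℕ) : ⊤ ∈ arrangementLattice n :=
  ⟨∅, Set.empty_subset _, sInf_empty.symm⟩

theorem inf_mem_arrangementLattice {n : ℕ} {K K' : Submodule ℝ (Fin n → ℝ)}
    (h : K ∈ arrangementLattice n) (h' : K' ∈ arrangementLattice n) :
    K ⊓ K' ∈ arrangementLattice n := by
  rw [inf_eq_iInf]
  exact iInf_mem_arrangementLattice (Bool.rec h' h)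

theorem ker_mem_arrangementLattice {n : ℕ} {l : Dual ℝ (Fin n → ℝ)} (hl : l ∈ forms n) :
    LinearMap.ker l ∈ arrangementLattice n := by
  refine ⟨{LinearMap.ker l}, ?_, sInf_singleton.symm⟩
  rw [reflectionArrangement_eq_image_ker, Set.singleton_subset_iff]
  exact Set.mem_image_of_mem _ hl

theorem ker_rootForm_mem_arrangementLattice {n : ℕ} (t : ℤˣ) (o o' : Fin (n + 1)) :
    LinearMap.ker (rootForm t o o') ∈ arrangementLattice n := by
  by_cases h : o ≠ o' ∨ t = -1 ∧ o ≠ Fin.last n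
  · obtain ⟨m, hm, c, hc, hcm⟩ := exists_rootForm_eq_smul h
    rw [hcm, LinearMap.ker_smul _ _ hc]
    exact ker_mem_arrangementLattice hm
  · have hzero : rootForm t o o' = 0 := by
      simp only [not_or, not_and, not_not] at h
      obtain ⟨rfl, h⟩ := h
      rcases Int.units_eq_one_or t with rfl | rfl
      · rw [rootForm, one_smul, sub_self]
      · rw [h rfl, rootForm, coord_last, smul_zero, sub_zero]
    rw [hzero, LinearMap.ker_zero]
    exact top_mem_arrangementLattice n

/-- The signed substitution of variables `(spread a s x)_i = ±x_{a(i)}`, with `x_{a(i)}` read as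
`0` if `a i = Fin.last k`. Elements of the lattice, the action of signed permutations and
coordinate projections are all of this form. -/
def spread {k n : ℕ} (a : Fin n → Fin (k + 1)) (s : Fin n → ℤˣ) :
    (Fin k → ℝ) →ₗ[ℝ] (Fin n → ℝ) :=
  LinearMap.pi fun i => s i • coord (a i)

theorem spread_apply {k n : ℕ} (a : Fin n → Fin (k + 1)) (s : Fin n → ℤˣ) (x : Fin k → ℝ)
    (i : Fin n) : spread a s x i = s i • coord (a i) x := rfl

/-- Extension of an index map of `spread` by the index of the zero coordinate. -/
def extendLast {k n : ℕ} (a : Fin n → Fin (k + 1)) : Fin (n + 1) → Fin (k + 1) :=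
  Fin.snoc (α := fun _ => Fin (k + 1)) a (Fin.last k)

/-- Extension of a choice of signs by the sign `1` at the index of the zero coordinate. -/
def extendOne {n : ℕ} (s : Fin n → ℤˣ) : Fin (n + 1) → ℤˣ :=
  Fin.snoc (α := fun _ => ℤˣ) s 1

@[simp] theorem extendLast_last {k n : ℕ} (a : Fin n → Fin (k + 1)) :
    extendLast a (Fin.last n) = Fin.last k := Fin.snoc_last ..

@[simp] theorem extendLast_castSucc {k n : ℕ} (a : Fin n → Fin (k + 1)) (i : Fin n) :
    extendLast a i.castSucc = a i := Fin.snoc_castSucc ..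

@[simp] theorem extendOne_last {n : ℕ} (s : Fin n → ℤˣ) : extendOne s (Fin.last n) = 1 :=
  Fin.snoc_last ..

@[simp] theorem extendOne_castSucc {n : ℕ} (s : Fin n → ℤˣ) (i : Fin n) :
    extendOne s i.castSucc = s i := Fin.snoc_castSucc ..

theorem coord_spread {k n : ℕ} (a : Fin n → Fin (k + 1)) (s : Fin n → ℤˣ) (x : Fin k → ℝ)
    (o : Fin (n + 1)) :
    coord o (spread a s x) = extendOne s o • coord (extendLast a o) x := by
  cases o using Fin.lastCases <;> simp [spread_apply]

theorem rootForm_spread {k n : ℕ} (a : Fin n → Fin (k + 1)) (s : Fin n → ℤˣ) (t : ℤˣ)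
    (o o' : Fin (n + 1)) (x : Fin k → ℝ) :
    rootForm t o o' (spread a s x) =
      extendOne s o •
        rootForm (extendOne s o * t * extendOne s o') (extendLast a o) (extendLast a o') x := by
  simp_rw [rootForm_apply, coord_spread, smul_sub, smul_smul, ← mul_assoc, Int.units_mul_self,
    one_mul]

theorem spread_spread {k m n : ℕ} (a : Fin n → Fin (m + 1)) (s : Fin n → ℤˣ)
    (b : Fin m → Fin (k + 1)) (t : Fin m → ℤˣ) (x : Fin k → ℝ) :
    spread a s (spread b t x) =
      spread (extendLast b ∘ a) (fun i => s i * extendOne t (a i)) x := by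
  ext i
  simp [spread_apply, coord_spread, smul_smul]

theorem spread_castSucc_one {n : ℕ} (x : Fin n → ℝ) : spread Fin.castSucc 1 x = x := by
  ext i
  simp [spread_apply]

/-- The index maps of `spread` that use every coordinate. -/
def IsBlockMap {k n : ℕ} (a : Fin n → Fin (k + 1)) : Prop :=
  ∀ c : Fin k, ∃ i, a i = c.castSucc

theorem spread_leftInverse {k n : ℕ} {a : Fin n → Fin (k + 1)} (s : Fin n → ℤˣ)
    {r : Fin k → Fin n} (hr : ∀ c, a (r c) = c.castSucc) :
    Function.LeftInverse (spread (Fin.castSucc ∘ r) (s ∘ r)) (spread a s) := fun x => by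
  simp only [spread_spread, Function.comp_def, extendLast_castSucc, extendOne_castSucc, hr,
    Int.units_mul_self]
  exact spread_castSucc_one x

theorem IsBlockMap.spread_injective {k n : ℕ} {a : Fin n → Fin (k + 1)} (ha : IsBlockMap a)
    (s : Fin n → ℤˣ) : Function.Injective (spread a s) := by
  choose r hr using ha
  exact (spread_leftInverse s hr).injective

theorem comap_spread_mem_arrangementLattice {k n : ℕ} (a : Fin n → Fin (k + 1))
    (s : Fin n → ℤˣ) {K : Submodule ℝ (Fin n → ℝ)} (hK : K ∈ arrangementLattice n) :
    K.comap (spread a s) ∈ arrangementLattice k := by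
  obtain ⟨S, hS, rfl⟩ := hK
  rw [reflectionArrangement_eq_image_ker] at hS
  rw [sInf_eq_iInf', Submodule.comap_iInf]
  refine iInf_mem_arrangementLattice fun ⟨H, hH⟩ => ?_
  obtain ⟨_, ⟨t, o, o', -, rfl⟩, rfl⟩ := hS hH
  convert ker_rootForm_mem_arrangementLattice (extendOne s o * t * extendOne s o')
    (extendLast a o) (extendLast a o') using 1
  ext x
  simp [rootForm_spread, smul_eq_zero_iff_eq]

theorem eqLocus_spread_mem_arrangementLattice {n : ℕ} (a : Fin n → Fin (n + 1))
    (s : Fin n → ℤˣ) :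
    LinearMap.eqLocus LinearMap.id (spread a s) ∈ arrangementLattice n := by
  convert iInf_mem_arrangementLattice fun i : Fin n =>
    ker_rootForm_mem_arrangementLattice (s i) i.castSucc (a i)
  ext x
  simp [funext_iff, spread_apply, rootForm_apply, sub_eq_zero]

theorem map_eq_comap_inf_eqLocus {R V W : Type*} [Semiring R] [AddCommMonoid V] [Module R V]
    [AddCommMonoid W] [Module R W] {f : V →ₗ[R] W} {g : W →ₗ[R] V}
    (h : Function.LeftInverse g f) (K : Submodule R V) :
    K.map f = K.comap g ⊓ LinearMap.eqLocus LinearMap.id (f ∘ₗ g) := by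
  ext y
  constructor
  · rintro ⟨x, hx, rfl⟩
    simpa [h x] using hx
  · rintro ⟨hy, hfg⟩
    exact ⟨g y, hy, hfg.symm⟩

theorem IsBlockMap.map_spread_mem_arrangementLattice {k n : ℕ} {a : Fin n → Fin (k + 1)}
    (ha : IsBlockMap a) (s : Fin n → ℤˣ) {K : Submodule ℝ (Fin k → ℝ)}
    (hK : K ∈ arrangementLattice k) : K.map (spread a s) ∈ arrangementLattice n := by
  choose r hr using ha
  rw [map_eq_comap_inf_eqLocus (spread_leftInverse s hr)]
  refine inf_mem_arrangementLattice (comap_spread_mem_arrangementLattice _ _ hK) ?_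
  rw [show spread a s ∘ₗ spread (Fin.castSucc ∘ r) (s ∘ r) = spread _ _ from
    LinearMap.ext fun x => spread_spread ..]
  exact eqLocus_spread_mem_arrangementLattice _ _

theorem IsBlockMap.inGeneralPosition_comap_spread {k n d : ℕ} {a : Fin n → Fin (k + 1)}
    (ha : IsBlockMap a) (s : Fin n → ℤˣ) {L : Submodule ℝ (Fin n → ℝ)}
    (hL : InGeneralPosition L d) : InGeneralPosition (L.comap (spread a s)) d := by
  intro K hK
  have hinj := ha.spread_injective s
  have hmap (K' : Submodule ℝ (Fin k → ℝ)) : finrank ℝ (K'.map (spread a s)) = finrank ℝ K' :=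
    (K'.equivMapOfInjective _ hinj).symm.finrank_eq
  have h := hL _ (ha.map_spread_mem_arrangementLattice s hK)
  rwa [inf_comm L, Submodule.map_inf_eq_map_inf_comap, hmap, hmap, inf_comm K] at h

theorem InGeneralPosition.finrank_eq {k d : ℕ} {L : Submodule ℝ (Fin k → ℝ)}
    (hL : InGeneralPosition L d) : finrank ℝ L = k - d := by
  have h := hL ⊤ (top_mem_arrangementLattice k)
  rw [inf_top_eq, finrank_top, finrank_fin_fun] at h
  rcases le_total d k with hd | hd
  · have := h.1 hd
    omega
  · rw [h.2 hd]
    omega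

theorem InGeneralPosition.eq_top {k : ℕ} {L : Submodule ℝ (Fin k → ℝ)}
    (hL : InGeneralPosition L 0) : L = ⊤ :=
  Submodule.eq_top_of_finrank_eq (by rw [hL.finrank_eq, finrank_fin_fun, Nat.sub_zero])

theorem InGeneralPosition.eq_bot_of_le {k d : ℕ} {L K : Submodule ℝ (Fin k → ℝ)}
    (hL : InGeneralPosition L d) (hK : K ∈ arrangementLattice k) (hKtop : K ≠ ⊤)
    (hLK : L ≤ K) : L = ⊥ := by
  have h := hL K hK
  have hlt := Submodule.finrank_lt hKtop
  have hL' := hL.finrank_eq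
  rw [inf_eq_left.2 hLK] at h
  rw [finrank_fin_fun] at hlt
  rw [← Submodule.finrank_eq_zero (R := ℝ)]
  rcases le_total d (finrank ℝ K) with hd | hd
  · have := h.1 hd
    omega
  · exact h.2 hd

theorem InGeneralPosition.sup_eq_top {k d : ℕ} {L K : Submodule ℝ (Fin k → ℝ)}
    (hL : InGeneralPosition L d) (hK : K ∈ arrangementLattice k) (hLK : L ⊓ K ≠ ⊥) :
    L ⊔ K = ⊤ := by
  have h := hL K hK
  have hL' := hL.finrank_eq
  have hsum := Submodule.finrank_sup_add_finrank_inf_eq L K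
  have hpos : finrank ℝ ↥(L ⊓ K) ≠ 0 := mt Submodule.finrank_eq_zero.1 hLK
  have hd : d < finrank ℝ K := not_le.1 fun hd => hpos (h.2 hd)
  have hKk := K.finrank_le
  rw [finrank_fin_fun] at hKk
  refine Submodule.eq_top_of_finrank_eq ?_
  rw [finrank_fin_fun]
  have := h.1 hd.le
  omega

/-- Forgetting the last coordinate. -/
abbrev dropLast (k : ℕ) : (Fin (k + 1) → ℝ) →ₗ[ℝ] (Fin k → ℝ) :=
  spread (Fin.castSucc ∘ Fin.castSucc) 1

theorem dropLast_apply {k : ℕ} (x : Fin (k + 1) → ℝ) (c : Fin k) :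
    dropLast k x c = x c.castSucc := by simp [spread_apply]

theorem dropLast_surjective (k : ℕ) : Function.Surjective (dropLast k) := fun y =>
  ⟨Fin.snoc (α := fun _ => ℝ) y 0, by ext c; simp [dropLast_apply]⟩

theorem finrank_comap_of_surjective {D V W : Type*} [DivisionRing D] [AddCommGroup V]
    [Module D V] [AddCommGroup W] [Module D W] [FiniteDimensional D V] {f : V →ₗ[D] W}
    (hf : Function.Surjective f) (K : Submodule D W) :
    finrank D (K.comap f) = finrank D K + finrank D (LinearMap.ker f) := by
  have h := (f.domRestrict (K.comap f)).finrank_range_add_finrank_ker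
  rw [LinearMap.range_domRestrict, Submodule.map_comap_eq_of_surjective hf,
    LinearMap.ker_domRestrict] at h
  rw [← h, (Submodule.submoduleOfEquivOfLe (LinearMap.ker_le_comap f)).finrank_eq.symm]
  rfl

theorem finrank_ker_dropLast (k : ℕ) : finrank ℝ (LinearMap.ker (dropLast k)) = 1 := by
  have h := (dropLast k).finrank_range_add_finrank_ker
  rw [LinearMap.range_eq_top.2 (dropLast_surjective k), finrank_top, finrank_fin_fun,
    finrank_fin_fun] at h
  omega

theorem bot_mem_arrangementLattice (n : ℕ) : ⊥ ∈ arrangementLattice n := by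
  convert eqLocus_spread_mem_arrangementLattice (fun _ => Fin.last n) 1
  ext x
  simp [funext_iff, spread_apply]

theorem InGeneralPosition.disjoint_ker_dropLast {k d : ℕ} {L : Submodule ℝ (Fin (k + 1) → ℝ)}
    (hL : InGeneralPosition L (d + 1)) : Disjoint L (LinearMap.ker (dropLast k)) := by
  have h := (hL (Submodule.comap (dropLast k) ⊥)
    (comap_spread_mem_arrangementLattice _ _ (bot_mem_arrangementLattice k))).2
  rw [Submodule.comap_bot, finrank_ker_dropLast] at h
  rw [disjoint_iff, ← Submodule.finrank_eq_zero (R := ℝ)]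
  exact h (Nat.le_add_left 1 d)

theorem InGeneralPosition.map_dropLast {k d : ℕ} {L : Submodule ℝ (Fin (k + 1) → ℝ)}
    (hL : InGeneralPosition L (d + 1)) : InGeneralPosition (L.map (dropLast k)) d := by
  intro K hK
  have h := hL (K.comap (dropLast k)) (comap_spread_mem_arrangementLattice _ _ hK)
  have hinj : Function.Injective ((dropLast k).domRestrict (L ⊓ K.comap (dropLast k))) :=
    LinearMap.injective_domRestrict_iff.2 (hL.disjoint_ker_dropLast.mono_left inf_le_left)
  have hrank : finrank ℝ ↥(L.map (dropLast k) ⊓ K) = finrank ℝ ↥(L ⊓ K.comap (dropLast k)) := by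
    rw [Submodule.map_inf_eq_map_inf_comap, ← LinearMap.range_domRestrict,
      LinearMap.finrank_range_of_inj hinj]
  rw [finrank_comap_of_surjective (dropLast_surjective k), finrank_ker_dropLast] at h
  rw [hrank]
  push_cast at h ⊢
  exact ⟨fun hd => by rw [h.1 (by omega)]; omega, fun hd => h.2 (by omega)⟩

/-! ### Counting the regions of a hyperplane arrangement -/

theorem ncard_image_congr {X α β : Type*} {s : Set X} {f : X → α} {g : X → β}
    (h : ∀ x ∈ s, ∀ y ∈ s, f x = f y ↔ g x = g y) : (f '' s).ncard = (g '' s).ncard := by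
  have hker : Setoid.ker (s.domRestrict f) = Setoid.ker (s.domRestrict g) :=
    Setoid.ext fun x y => h x x.2 y y.2
  rw [← Set.range_domRestrict, ← Set.range_domRestrict, ← Nat.card_coe_set_eq,
    ← Nat.card_coe_set_eq, ← Nat.card_congr (Setoid.quotientKerEquivRange _), hker,
    Nat.card_congr (Setoid.quotientKerEquivRange _)]

section Regions

variable {E : Type*} [AddCommGroup E] [Module ℝ E]

theorem eventually_pos_add_smul {f : Dual ℝ E} {x : E} (hx : 0 < f x) (w : E) :
    ∀ᶠ c : ℝ in 𝓝[>] 0, 0 < f (x + c • w) := by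
  have hlim : Tendsto (fun c : ℝ => f x + c * f w) (𝓝[>] 0) (𝓝 (f x + 0 * f w)) :=
    (Continuous.tendsto (by fun_prop) 0).mono_left nhdsWithin_le_nhds
  simpa using hlim.eventually_const_lt (by simpa using hx)

theorem eventually_sign_add_smul {f : Dual ℝ E} {x : E} (hx : f x ≠ 0) (w : E) :
    ∀ᶠ c : ℝ in 𝓝[>] 0, SignType.sign (f (x + c • w)) = SignType.sign (f x) := by
  rcases lt_or_gt_of_ne hx with h | h
  · filter_upwards [eventually_pos_add_smul (f := -f) (neg_pos.2 h) w] with c hc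
    rw [sign_neg h, sign_neg (neg_pos.1 hc)]
  · filter_upwards [eventually_pos_add_smul h w] with c hc
    rw [sign_pos h, sign_pos hc]

/-- The signs at `x` of the linear forms in `S`. -/
def signVector (S : Set (Dual ℝ E)) (x : E) : S → SignType := fun l => SignType.sign (l.1 x)

theorem signVector_eq_iff {S : Set (Dual ℝ E)} {x y : E} :
    signVector S x = signVector S y ↔ ∀ l ∈ S, SignType.sign (l x) = SignType.sign (l y) := by
  rw [funext_iff, Subtype.forall]
  rfl

theorem finite_image_signVector {S : Set (Dual ℝ E)} (hS : S.Finite) (s : Set E) :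
    (signVector S '' s).Finite :=
  haveI := hS.to_subtype
  Set.toFinite _

/-- The points of `L` lying on none of the hyperplanes `l = 0`, `l ∈ S`. -/
def genericPoints (S : Set (Dual ℝ E)) (L : Submodule ℝ E) : Set E :=
  {x | x ∈ L ∧ ∀ l ∈ S, l x ≠ 0}

/-- The regions into which the hyperplanes `l = 0`, `l ∈ S`, cut the subspace `L`; a region is
represented by the sign vector of its points. -/
def regions (S : Set (Dual ℝ E)) (L : Submodule ℝ E) : Set (S → SignType) :=
  signVector S '' genericPoints S L

/-- The generic points of `L` on the positive side of the hyperplane `h = 0`. -/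
def genericPointsPos (S : Set (Dual ℝ E)) (L : Submodule ℝ E) (h : Dual ℝ E) : Set E :=
  {x ∈ genericPoints S L | 0 < h x}

theorem mem_genericPoints_of_signVector_eq {S : Set (Dual ℝ E)} {L L' : Submodule ℝ E} {x y : E}
    (hx : x ∈ genericPoints S L) (hy : y ∈ L') (h : signVector S y = signVector S x) :
    y ∈ genericPoints S L' :=
  ⟨hy, fun l hl => by
    rw [← sign_ne_zero, signVector_eq_iff.1 h l hl, sign_ne_zero]
    exact hx.2 l hl⟩

theorem exists_signVector_add_smul_eq {S : Set (Dual ℝ E)} (hS : S.Finite) {L : Submodule ℝ E}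
    {x : E} (hx : x ∈ genericPoints S L) (w : E) :
    ∃ c : ℝ, 0 < c ∧ signVector S (x + c • w) = signVector S x := by
  have hev := (eventually_all_finite hS).2 fun l hl => eventually_sign_add_smul (hx.2 l hl) w
  obtain ⟨c, hc, hc0⟩ := (hev.and self_mem_nhdsWithin).exists
  exact ⟨c, hc0, signVector_eq_iff.2 hc⟩

theorem sign_add_eq {α : Type*} [AddCommGroup α] [LinearOrder α] [IsOrderedAddMonoid α] {a b : α}
    (h : SignType.sign b = SignType.sign a) :
    SignType.sign (a + b) = SignType.sign a := by
  rcases lt_trichotomy a 0 with ha | rfl | ha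
  · rw [sign_neg ha, sign_eq_neg_one_iff] at *
    exact add_neg ha h
  · rw [sign_zero, sign_eq_zero_iff] at *
    rw [h, add_zero]
  · rw [sign_pos ha, sign_eq_one_iff] at *
    exact add_pos ha h

theorem signVector_smul_add_smul {S : Set (Dual ℝ E)} {x y : E}
    (h : signVector S y = signVector S x) {a b : ℝ} (ha : 0 < a) (hb : 0 < b) :
    signVector S (a • x + b • y) = signVector S x := by
  rw [signVector_eq_iff] at h ⊢
  intro l hl
  have hsign (c : ℝ) (hc : 0 < c) (z : E) :
      SignType.sign (l (c • z)) = SignType.sign (l z) := by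
    rw [map_smul, smul_eq_mul, sign_mul, sign_pos hc, one_mul]
  rw [map_add, sign_add_eq, hsign a ha]
  rw [hsign a ha, hsign b hb, h l hl]

theorem regions_inf_ker_subset {S : Set (Dual ℝ E)} (hS : S.Finite) {L : Submodule ℝ E}
    {h : Dual ℝ E} {v : E} (hvL : v ∈ L) (hv : 0 < h v) :
    regions S (L ⊓ LinearMap.ker h) ⊆ signVector S '' genericPointsPos S L h := by
  rintro _ ⟨x, hx, rfl⟩
  obtain ⟨c, hc, hcx⟩ := exists_signVector_add_smul_eq hS hx v
  have hL : x + c • v ∈ L := L.add_mem hx.1.1 (L.smul_mem c hvL)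
  refine ⟨x + c • v, ⟨mem_genericPoints_of_signVector_eq hx hL hcx, ?_⟩, hcx⟩
  rw [map_add, hx.1.2, map_smul, zero_add]
  exact mul_pos hc hv

theorem exists_mem_pos_of_not_le_ker {L : Submodule ℝ E} {h : Dual ℝ E}
    (hL : ¬ L ≤ LinearMap.ker h) : ∃ v ∈ L, 0 < h v := by
  obtain ⟨v, hvL, hv⟩ := SetLike.not_le_iff_exists.1 hL
  rcases lt_or_gt_of_ne hv with hv | hv
  · exact ⟨-v, L.neg_mem hvL, by rwa [map_neg, neg_pos]⟩
  · exact ⟨v, hvL, hv⟩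

theorem image_genericPointsPos_inter_neg {S : Set (Dual ℝ E)} (hS : S.Finite)
    {L : Submodule ℝ E} {h : Dual ℝ E} (hL : ¬ L ≤ LinearMap.ker h) :
    signVector S '' genericPointsPos S L h ∩ signVector S '' genericPointsPos S L (-h) =
      regions S (L ⊓ LinearMap.ker h) := by
  obtain ⟨v, hvL, hv⟩ := exists_mem_pos_of_not_le_ker hL
  refine Set.Subset.antisymm ?_ (Set.subset_inter (regions_inf_ker_subset hS hvL hv) ?_)
  · rintro _ ⟨⟨x, ⟨hx, hxpos⟩, rfl⟩, y, ⟨hy, hyneg⟩, hyx⟩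
    have hz := signVector_smul_add_smul hyx hyneg hxpos
    refine ⟨_, mem_genericPoints_of_signVector_eq hx ⟨?_, ?_⟩ hz, hz⟩
    · exact L.add_mem (L.smul_mem _ hx.1) (L.smul_mem _ hy.1)
    · simp [mul_comm]
  · have hker : LinearMap.ker h = LinearMap.ker (-h) := by
      ext; simp
    rw [hker]
    exact regions_inf_ker_subset hS (L.neg_mem hvL) (by simpa using hv)

theorem image_genericPointsPos_union_neg {S : Set (Dual ℝ E)} (hS : S.Finite)
    {L : Submodule ℝ E} {h : Dual ℝ E} (hL : ¬ L ≤ LinearMap.ker h) :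
    signVector S '' genericPointsPos S L h ∪ signVector S '' genericPointsPos S L (-h) =
      regions S L := by
  refine Set.Subset.antisymm (Set.union_subset ?_ ?_) ?_
  · exact Set.image_mono (Set.sep_subset _ _)
  · exact Set.image_mono (Set.sep_subset _ _)
  rintro _ ⟨x, hx, rfl⟩
  rcases lt_trichotomy (h x) 0 with h0 | h0 | h0
  · exact Or.inr ⟨x, ⟨hx, neg_pos.2 h0⟩, rfl⟩
  · obtain ⟨v, hvL, hv⟩ := exists_mem_pos_of_not_le_ker hL
    exact Or.inl (regions_inf_ker_subset hS hvL hv ⟨x, ⟨⟨hx.1, h0⟩, hx.2⟩, rfl⟩)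
  · exact Or.inl ⟨x, ⟨hx, h0⟩, rfl⟩

theorem genericPoints_insert (S : Set (Dual ℝ E)) (L : Submodule ℝ E) (h : Dual ℝ E) :
    genericPoints (insert h S) L = genericPointsPos S L h ∪ genericPointsPos S L (-h) := by
  ext x
  simp only [genericPoints, genericPointsPos, Set.mem_ofPred_eq, Set.forall_mem_insert,
    Set.mem_union, LinearMap.neg_apply, neg_pos, ne_iff_lt_or_gt (a := h x)]
  tauto

theorem ncard_image_signVector_insert {S : Set (Dual ℝ E)} {s : Set E} {h : Dual ℝ E}
    {σ : SignType} (hs : ∀ x ∈ s, SignType.sign (h x) = σ) :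
    (signVector (insert h S) '' s).ncard = (signVector S '' s).ncard :=
  ncard_image_congr fun x hx y hy => by
    rw [signVector_eq_iff, signVector_eq_iff, Set.forall_mem_insert, hs x hx, hs y hy,
      and_iff_right rfl]

/-- Deletion and restriction: the hyperplane `h = 0` cuts in two exactly those regions which it
meets. -/
theorem ncard_regions_insert {S : Set (Dual ℝ E)} (hS : S.Finite) {L : Submodule ℝ E}
    {h : Dual ℝ E} (hL : ¬ L ≤ LinearMap.ker h) :
    (regions (insert h S) L).ncard =
      (regions S L).ncard + (regions S (L ⊓ LinearMap.ker h)).ncard := by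
  have hpos : ∀ x ∈ genericPointsPos S L h, SignType.sign (h x) = 1 := fun x hx => sign_pos hx.2
  have hneg : ∀ x ∈ genericPointsPos S L (-h), SignType.sign (h x) = -1 := fun x hx =>
    sign_neg (neg_pos.1 hx.2)
  have hdisj : Disjoint (signVector (insert h S) '' genericPointsPos S L h)
      (signVector (insert h S) '' genericPointsPos S L (-h)) := by
    rw [Set.disjoint_left]
    rintro _ ⟨x, hx, rfl⟩ ⟨y, hy, hyx⟩
    have hsign := signVector_eq_iff.1 hyx h (Set.mem_insert h S)
    rw [hpos x hx, hneg y hy] at hsign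
    exact absurd hsign (by decide)
  rw [regions, genericPoints_insert, Set.image_union,
    Set.ncard_union_eq hdisj (finite_image_signVector (hS.insert h) _)
      (finite_image_signVector (hS.insert h) _),
    ncard_image_signVector_insert hpos, ncard_image_signVector_insert hneg,
    ← Set.ncard_union_add_ncard_inter _ _ (finite_image_signVector hS _)
      (finite_image_signVector hS _),
    image_genericPointsPos_union_neg hS hL, image_genericPointsPos_inter_neg hS hL]

theorem ncard_regions_eq_of_proportional {S T : Set (Dual ℝ E)} {L : Submodule ℝ E}
    (hST : S ⊆ T)
    (hT : ∀ l ∈ T, ∃ m ∈ S, ∃ c : ℝ, c ≠ 0 ∧ ∀ x ∈ L, l x = c * m x) :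
    (regions T L).ncard = (regions S L).ncard := by
  have hgen : genericPoints T L = genericPoints S L := by
    ext x
    refine ⟨fun hx => ⟨hx.1, fun l hl => hx.2 l (hST hl)⟩, fun hx => ⟨hx.1, fun l hl => ?_⟩⟩
    obtain ⟨m, hm, c, hc, hlm⟩ := hT l hl
    rw [hlm x hx.1]
    exact mul_ne_zero hc (hx.2 m hm)
  rw [regions, regions, hgen]
  refine ncard_image_congr fun x hx y hy => ?_
  rw [signVector_eq_iff, signVector_eq_iff]
  refine ⟨fun h l hl => h l (hST hl), fun h l hl => ?_⟩
  obtain ⟨m, hm, c, -, hlm⟩ := hT l hl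
  rw [hlm x hx.1, hlm y hy.1, sign_mul, sign_mul, h m hm]

theorem ncard_regions_union_image {ι : Type*} {S : Set (Dual ℝ E)} (hS : S.Finite)
    {L : Submodule ℝ E} {h : ι → Dual ℝ E} (T : Finset ι)
    (hL : ∀ a ∈ T, ¬ L ≤ LinearMap.ker (h a))
    (hT : ∀ a ∈ T, ∀ b ∈ T, a ≠ b → ∃ m ∈ S, ∃ c : ℝ, c ≠ 0 ∧
      ∀ x ∈ LinearMap.ker (h a), h b x = c * m x) :
    (regions (S ∪ h '' T) L).ncard =
      (regions S L).ncard + ∑ a ∈ T, (regions S (L ⊓ LinearMap.ker (h a))).ncard := by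
  classical
  induction T using Finset.induction_on with
  | empty =>
    rw [Finset.coe_empty, Set.image_empty, Set.union_empty, Finset.sum_empty, add_zero]
  | insert a T ha ih =>
    have ih' := ih (fun b hb => hL b (Finset.mem_insert_of_mem hb)) fun b hb c hc =>
      hT b (Finset.mem_insert_of_mem hb) c (Finset.mem_insert_of_mem hc)
    have hrestrict : (regions (S ∪ h '' T) (L ⊓ LinearMap.ker (h a))).ncard =
        (regions S (L ⊓ LinearMap.ker (h a))).ncard := by
      refine ncard_regions_eq_of_proportional Set.subset_union_left ?_
      rintro l (hl | ⟨b, hb, rfl⟩)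
      · exact ⟨l, hl, 1, one_ne_zero, fun x _ => (one_mul _).symm⟩
      · obtain ⟨m, hm, c, hc, hbm⟩ := hT a (Finset.mem_insert_self a T) b
          (Finset.mem_insert_of_mem hb) (ne_of_mem_of_not_mem hb ha).symm
        exact ⟨m, hm, c, hc, fun x hx => hbm x hx.2⟩
    rw [Finset.sum_insert ha, Finset.coe_insert, Set.image_insert_eq, Set.union_insert,
      ncard_regions_insert (hS.union (T.finite_toSet.image h))
        (hL a (Finset.mem_insert_self a T)), ih', hrestrict]
    ring

theorem ncard_regions_image_comp {E' : Type*} [AddCommGroup E'] [Module ℝ E'] (p : E →ₗ[ℝ] E')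
    (S : Set (Dual ℝ E')) (L : Submodule ℝ E) :
    (regions ((· ∘ₗ p) '' S) L).ncard = (regions S (L.map p)).ncard := by
  have hgen : genericPoints S (L.map p) = p '' genericPoints ((· ∘ₗ p) '' S) L := by
    ext y
    constructor
    · rintro ⟨⟨x, hx, rfl⟩, hy⟩
      exact ⟨x, ⟨hx, Set.forall_mem_image.2 hy⟩, rfl⟩
    · rintro ⟨x, ⟨hx, hy⟩, rfl⟩
      exact ⟨⟨x, hx, rfl⟩, fun l hl => hy _ (Set.mem_image_of_mem _ hl)⟩
  rw [regions, regions, hgen, Set.image_image]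
  refine ncard_image_congr fun x _ y _ => ?_
  rw [signVector_eq_iff, signVector_eq_iff, Set.forall_mem_image]
  rfl

theorem regions_bot {S : Set (Dual ℝ E)} (hS : S.Nonempty) :
    regions S (⊥ : Submodule ℝ E) = ∅ := by
  obtain ⟨l, hl⟩ := hS
  rw [regions, Set.image_eq_empty, Set.eq_empty_iff_forall_notMem]
  rintro x ⟨hx, h⟩
  exact h l hl (by rw [(Submodule.mem_bot ℝ).1 hx, map_zero])

end Regions

/-! ### Weyl chambers as regions -/

section UnitSMul

variable {R : Type*} [Ring R] [LinearOrder R]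

theorem abs_unit_smul (u : ℤˣ) (r : R) : |u • r| = |r| := by
  rcases Int.units_eq_one_or u with rfl | rfl <;> simp

theorem exists_unit_smul_eq_abs (r : R) : ∃ u : ℤˣ, u • r = |r| := by
  rcases abs_choice r with h | h
  · exact ⟨1, by rw [h, one_smul]⟩
  · exact ⟨-1, by rw [h, Units.neg_smul, one_smul]⟩

variable [IsOrderedRing R]

theorem sign_unit_smul_inj (u : ℤˣ) {r r' : R} :
    SignType.sign (u • r) = SignType.sign (u • r') ↔ SignType.sign r = SignType.sign r' := by
  rcases Int.units_eq_one_or u with rfl | rfl <;> simp [Units.smul_def, Left.sign_neg]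

theorem unit_eq_of_smul_pos {u v : ℤˣ} {r : R} (hu : 0 < u • r) (hv : 0 < v • r) : u = v := by
  rcases Int.units_eq_one_or u with rfl | rfl <;> rcases Int.units_eq_one_or v with rfl | rfl <;>
    first
    | rfl
    | (simp only [one_smul, Units.neg_smul, Left.neg_pos_iff] at hu hv; exact (hu.asymm hv).elim)

end UnitSMul

/-- The coordinates of `signedPerm (ε, σ) x` are the numbers `ε_i x_{σ(i)}`. -/
abbrev signedPerm {k : ℕ} (p : (Fin k → ℤˣ) × Equiv.Perm (Fin k)) :
    (Fin k → ℝ) →ₗ[ℝ] (Fin k → ℝ) :=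
  spread (Fin.castSucc ∘ p.2) p.1

/-- The interior `ε₁ x_{σ(1)} > ⋯ > ε_k x_{σ(k)} > 0` of a Weyl chamber; the coordinate at
`Fin.last k` provides the final `0`. -/
def openChamber {k : ℕ} (p : (Fin k → ℤˣ) × Equiv.Perm (Fin k)) : Set (Fin k → ℝ) :=
  {x | StrictAnti fun o : Fin (k + 1) => coord o (signedPerm p x)}

/-- The Weyl chambers whose interior meets `L`. -/
def meetingChambers {k : ℕ} (L : Submodule ℝ (Fin k → ℝ)) :
    Set ((Fin k → ℤˣ) × Equiv.Perm (Fin k)) :=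
  {p | ∃ x ∈ L, x ∈ openChamber p}

theorem mem_chamber_iff {k : ℕ} {p : (Fin k → ℤˣ) × Equiv.Perm (Fin k)} {x : Fin k → ℝ} :
    x ∈ chamber p.1 p.2 ↔ Antitone fun o : Fin (k + 1) => coord o (signedPerm p x) := by
  have hval (i : Fin k) : ((p.1 i : ℤ) : ℝ) * x (p.2 i) =
      coord i.castSucc (signedPerm p x) := by simp [spread_apply, Units.smul_def]
  change ((∀ i j : Fin k, i ≤ j → _) ∧ ∀ i : Fin k, _) ↔ _
  simp only [hval]
  refine ⟨fun ⟨h, h0⟩ o o' hoo' => ?_, fun h => ⟨fun i j hij => ?_, fun i => ?_⟩⟩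
  · cases o' using Fin.lastCases with
    | last =>
      cases o using Fin.lastCases with
      | last => exact le_rfl
      | cast i => simpa using h0 i
    | cast j =>
      obtain ⟨i, rfl⟩ := Fin.exists_castSucc_eq.2
        (Fin.ne_last_of_lt (hoo'.trans_lt j.castSucc_lt_last))
      exact h i j (Fin.castSucc_le_castSucc_iff.1 hoo')
  · exact h (Fin.castSucc_le_castSucc_iff.2 hij)
  · simpa using h (Fin.le_last i.castSucc)

theorem forms_ne_zero_iff {k : ℕ} {x : Fin k → ℝ} :
    (∀ l ∈ forms k, l x ≠ 0) ↔ Function.Injective fun o : Fin (k + 1) => |coord o x| := by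
  constructor
  · intro h
    refine Function.injective_iff_pairwise_ne.2 fun o o' hoo' heq => ?_
    obtain ⟨t, ht⟩ : ∃ t : ℤˣ, rootForm t o o' x = 0 := by
      rcases abs_eq_abs.1 heq with h | h
      · exact ⟨1, by rw [rootForm_apply, h, one_smul, sub_self]⟩
      · exact ⟨-1, by rw [rootForm_apply, h, Units.neg_smul, one_smul, sub_self]⟩
    obtain ⟨u, hu⟩ := exists_smul_rootForm_mem_forms t hoo'
    exact h _ hu (by rw [LinearMap.smul_apply, ht, smul_zero])
  · rintro h _ ⟨t, o, o', hlt, rfl⟩ h0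
    rw [rootForm_apply, sub_eq_zero] at h0
    exact hlt.ne (h (by simp only [h0, abs_unit_smul]))

theorem abs_coord_spread {k n : ℕ} (a : Fin n → Fin (k + 1)) (s : Fin n → ℤˣ) (x : Fin k → ℝ)
    (o : Fin (n + 1)) : |coord o (spread a s x)| = |coord (extendLast a o) x| := by
  rw [coord_spread, abs_unit_smul]

theorem extendLast_perm_bijective {k : ℕ} (σ : Equiv.Perm (Fin k)) :
    Function.Bijective (extendLast (Fin.castSucc ∘ σ)) := by
  refine Finite.injective_iff_bijective.1 fun o o' h => ?_
  cases o using Fin.lastCases <;> cases o' using Fin.lastCases <;>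
    simp_all [(Fin.castSucc_ne_last _).symm]

theorem abs_coord_of_antitone {k : ℕ} {p : (Fin k → ℤˣ) × Equiv.Perm (Fin k)} {x : Fin k → ℝ}
    (h : Antitone fun o : Fin (k + 1) => coord o (signedPerm p x)) (o : Fin (k + 1)) :
    |coord (extendLast (Fin.castSucc ∘ p.2) o) x| = coord o (signedPerm p x) := by
  rw [← abs_coord_spread _ p.1, abs_of_nonneg]
  simpa using h (Fin.le_last o)

theorem forms_ne_zero_of_mem_openChamber {k : ℕ} {p : (Fin k → ℤˣ) × Equiv.Perm (Fin k)}
    {x : Fin k → ℝ} (hx : x ∈ openChamber p) : ∀ l ∈ forms k, l x ≠ 0 := by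
  rw [forms_ne_zero_iff, ← Function.Injective.of_comp_iff' _ (extendLast_perm_bijective p.2)]
  refine fun o o' h => hx.injective ?_
  simpa only [Function.comp_apply, abs_coord_of_antitone hx.antitone] using h

theorem exists_mem_openChamber_of_forms_ne_zero {k : ℕ} {x : Fin k → ℝ}
    (hx : ∀ l ∈ forms k, l x ≠ 0) : ∃ p, x ∈ openChamber p := by
  set σ := Tuple.sort fun i => -|x i|
  choose ε hε using fun i => exists_unit_smul_eq_abs (x (σ i))
  have hmem : x ∈ chamber ε σ := by
    have hσ : Antitone fun i => |x (σ i)| := fun i j hij =>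
      neg_le_neg_iff.1 (Tuple.monotone_sort (fun i => -|x i|) hij)
    have hval (i : Fin k) : ((ε i : ℤ) : ℝ) * x (σ i) = |x (σ i)| := by
      rw [← zsmul_eq_mul, ← Units.smul_def, hε]
    refine ⟨fun i j hij => ?_, fun i => ?_⟩
    · rw [hval, hval]
      exact hσ hij
    · rw [hval]
      exact abs_nonneg _
  have hanti := mem_chamber_iff (p := (ε, σ)).1 hmem
  refine ⟨(ε, σ), hanti.strictAnti_of_injective ?_⟩
  exact funext (abs_coord_of_antitone hanti) ▸
    (forms_ne_zero_iff.1 hx).comp (extendLast_perm_bijective σ).1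

theorem eq_of_mem_openChamber {k : ℕ} {p q : (Fin k → ℤˣ) × Equiv.Perm (Fin k)}
    {x : Fin k → ℝ} (hp : x ∈ openChamber p) (hq : x ∈ openChamber q) : p = q := by
  have hanti {r : (Fin k → ℤˣ) × Equiv.Perm (Fin k)} (hr : x ∈ openChamber r) :
      StrictAnti ((fun i => |x i|) ∘ r.2) := fun i j hij => by
    have h := hr (Fin.castSucc_lt_castSucc_iff.2 hij)
    simp only [← abs_coord_of_antitone hr.antitone] at h
    simpa using h
  have hinj : Function.Injective fun i => |x i| :=
    (Function.Injective.of_comp_iff' _ p.2.bijective).1 (hanti hp).injective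
  have hσ : p.2 = q.2 := Equiv.ext fun i =>
    hinj (congrFun (Tuple.unique_antitone (hanti hp).antitone (hanti hq).antitone) i)
  refine Prod.ext (funext fun i => ?_) hσ
  have hpos {r : (Fin k → ℤˣ) × Equiv.Perm (Fin k)} (hr : x ∈ openChamber r) :
      0 < r.1 i • x (r.2 i) := by
    simpa [spread_apply] using hr i.castSucc_lt_last
  exact unit_eq_of_smul_pos (hpos hp) (hσ ▸ hpos hq)

theorem smul_add_smul_mem_openChamber {k : ℕ} {p : (Fin k → ℤˣ) × Equiv.Perm (Fin k)}
    {x y : Fin k → ℝ} (hx : x ∈ openChamber p) (hy : y ∈ openChamber p) {a b : ℝ} (ha : 0 < a)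
    (hb : 0 < b) : a • x + b • y ∈ openChamber p := fun o o' h => by
  simp only [map_add, map_smul, smul_eq_mul]
  exact add_lt_add (mul_lt_mul_of_pos_left (hx h) ha) (mul_lt_mul_of_pos_left (hy h) hb)

theorem sign_eq_of_mem_openChamber {k : ℕ} {p : (Fin k → ℤˣ) × Equiv.Perm (Fin k)}
    {x y : Fin k → ℝ} (hx : x ∈ openChamber p) (hy : y ∈ openChamber p)
    {l : Dual ℝ (Fin k → ℝ)} (hl : l ∈ forms k) :
    SignType.sign (l x) = SignType.sign (l y) := by
  -- If `l x` and `l y` had opposite signs, `l` would vanish somewhere between `x` and `y`.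
  have key {x y} (hx : x ∈ openChamber p) (hy : y ∈ openChamber p) (hlx : l x < 0)
      (hly : 0 < l y) : False := by
    refine forms_ne_zero_of_mem_openChamber
      (smul_add_smul_mem_openChamber hx hy hly (neg_pos.2 hlx)) l hl ?_
    simp [mul_comm]
  rcases lt_or_gt_of_ne (forms_ne_zero_of_mem_openChamber hx l hl) with hlx | hlx <;>
    rcases lt_or_gt_of_ne (forms_ne_zero_of_mem_openChamber hy l hl) with hly | hly
  · rw [sign_neg hlx, sign_neg hly]
  · exact (key hx hy hlx hly).elim
  · exact (key hy hx hly hlx).elim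
  · rw [sign_pos hlx, sign_pos hly]

theorem sign_rootForm_eq {k : ℕ} {x y : Fin k → ℝ}
    (h : signVector (forms k) x = signVector (forms k) y) (t : ℤˣ) {o o' : Fin (k + 1)}
    (hoo' : o ≠ o') :
    SignType.sign (rootForm t o o' x) = SignType.sign (rootForm t o o' y) := by
  obtain ⟨u, hu⟩ := exists_smul_rootForm_mem_forms t hoo'
  exact (sign_unit_smul_inj u).1 (signVector_eq_iff.1 h _ hu)

theorem mem_openChamber_of_signVector_eq {k : ℕ} {p : (Fin k → ℤˣ) × Equiv.Perm (Fin k)}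
    {x y : Fin k → ℝ} (hx : x ∈ openChamber p)
    (h : signVector (forms k) x = signVector (forms k) y) : y ∈ openChamber p := by
  intro o o' hlt
  have hsign : SignType.sign (rootForm 1 o o' (signedPerm p x)) =
      SignType.sign (rootForm 1 o o' (signedPerm p y)) := by
    rw [rootForm_spread, rootForm_spread, sign_unit_smul_inj]
    exact sign_rootForm_eq h _ ((extendLast_perm_bijective p.2).1.ne hlt.ne)
  simp only [rootForm_apply, one_smul] at hsign
  rw [sign_pos (sub_pos.2 (hx hlt)), eq_comm, sign_eq_one_iff, sub_pos] at hsign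
  exact hsign

theorem ncard_meetingChambers {k : ℕ} (L : Submodule ℝ (Fin k → ℝ)) :
    (meetingChambers L).ncard = (regions (forms k) L).ncard := by
  have hex (x : Fin k → ℝ) : ∃ p, (∀ l ∈ forms k, l x ≠ 0) → x ∈ openChamber p := by
    by_cases hx : ∀ l ∈ forms k, l x ≠ 0
    · obtain ⟨p, hp⟩ := exists_mem_openChamber_of_forms_ne_zero hx
      exact ⟨p, fun _ => hp⟩
    · exact ⟨(1, 1), fun h => (hx h).elim⟩
  choose chamberOf hmem using hex
  have himage : meetingChambers L = chamberOf '' genericPoints (forms k) L := by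
    ext p
    constructor
    · rintro ⟨x, hxL, hx⟩
      have hgen := forms_ne_zero_of_mem_openChamber hx
      exact ⟨x, ⟨hxL, hgen⟩, eq_of_mem_openChamber (hmem x hgen) hx⟩
    · rintro ⟨x, hx, rfl⟩
      exact ⟨x, hx.1, hmem x hx.2⟩
  rw [himage, regions]
  refine ncard_image_congr fun x hx y hy => ⟨fun h => ?_, fun h => ?_⟩
  · have hy' := hmem y hy.2
    rw [← h] at hy'
    exact signVector_eq_iff.2 fun l => sign_eq_of_mem_openChamber (hmem x hx.2) hy'
  · exact eq_of_mem_openChamber (mem_openChamber_of_signVector_eq (hmem x hx.2) h)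
      (hmem y hy.2)

theorem meetingChambers_top (k : ℕ) :
    meetingChambers (⊤ : Submodule ℝ (Fin k → ℝ)) = Set.univ := by
  refine Set.eq_univ_of_forall fun p => ?_
  have hblock : IsBlockMap (Fin.castSucc ∘ p.2) := fun c => ⟨p.2.symm c, by simp⟩
  obtain ⟨x, hx⟩ := LinearMap.injective_iff_surjective.1 (hblock.spread_injective p.1)
    fun i : Fin k => (k : ℝ) - i
  refine ⟨x, Submodule.mem_top, fun o o' h => ?_⟩
  have hcoord (o : Fin (k + 1)) : coord o (signedPerm p x) = k - o := by
    rw [hx]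
    cases o using Fin.lastCases <;> simp
  simpa only [hcoord] using sub_lt_sub_left (Nat.cast_lt.2 h) (k : ℝ)

theorem forms_nonempty {k : ℕ} (hk : 1 ≤ k) : (forms k).Nonempty :=
  ⟨_, 1, Fin.castSucc ⟨0, hk⟩, Fin.last k, Fin.castSucc_lt_last _, rfl⟩

/-- Labels for the hyperplanes of the arrangement in `ℝᵏ⁺¹` which involve the last coordinate:
`none` stands for `x_last = 0` and `some (i, t)` for `x_last = t x_i`. In both cases the equation is
`x_last = lastSign q • coord (lastIndex q) (dropLast k x)`. -/
abbrev LastLabel (k : ℕ) := Option (Fin k × ℤˣ)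

/-- The index of the coordinate to which the last one is proportional on the hyperplane `q`. -/
def lastIndex {k : ℕ} (q : LastLabel k) : Fin (k + 1) := q.elim (Fin.last k) (·.1.castSucc)

/-- The factor between the two coordinates which are proportional on the hyperplane `q`. -/
def lastSign {k : ℕ} (q : LastLabel k) : ℤˣ := q.elim 1 (·.2)

/-- The member of `forms (k + 1)` defining the hyperplane `q`. -/
def lastForm {k : ℕ} (q : LastLabel k) : Dual ℝ (Fin (k + 1) → ℝ) :=
  q.elim (rootForm 1 (Fin.last k).castSucc (Fin.last (k + 1)))
    fun q => rootForm q.2 q.1.castSucc.castSucc (Fin.last k).castSucc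

/-- The parametrization of the hyperplane `q` by its first `k` coordinates. -/
abbrev lastSpread {k : ℕ} (q : LastLabel k) : (Fin k → ℝ) →ₗ[ℝ] (Fin (k + 1) → ℝ) :=
  spread (Fin.snoc (α := fun _ => Fin (k + 1)) Fin.castSucc (lastIndex q))
    (Fin.snoc (α := fun _ => ℤˣ) 1 (lastSign q))

theorem isBlockMap_snoc_castSucc {k : ℕ} (o : Fin (k + 1)) :
    IsBlockMap (Fin.snoc (α := fun _ => Fin (k + 1)) Fin.castSucc o) :=
  fun c => ⟨c.castSucc, Fin.snoc_castSucc ..⟩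

theorem exists_lastForm_apply_eq {k : ℕ} (q : LastLabel k) :
    ∃ u : ℤˣ, ∀ x, lastForm q x =
      u • (x (Fin.last k) - lastSign q • coord (lastIndex q) (dropLast k x)) := by
  rcases q with _ | ⟨i, t⟩
  · exact ⟨1, fun x => by simp [lastForm, lastSign, lastIndex, rootForm_apply]⟩
  · refine ⟨-t, fun x => ?_⟩
    simp [lastForm, lastSign, lastIndex, rootForm_apply, smul_sub, smul_smul, dropLast_apply,
      Units.neg_smul, Int.units_mul_self, neg_add_eq_sub]

theorem mem_ker_lastForm {k : ℕ} {q : LastLabel k} {x : Fin (k + 1) → ℝ} :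
    x ∈ LinearMap.ker (lastForm q) ↔
      x (Fin.last k) = lastSign q • coord (lastIndex q) (dropLast k x) := by
  obtain ⟨u, hu⟩ := exists_lastForm_apply_eq q
  rw [LinearMap.mem_ker, hu, smul_eq_zero_iff_eq, sub_eq_zero]

theorem dropLast_lastSpread {k : ℕ} (q : LastLabel k) (y : Fin k → ℝ) :
    dropLast k (lastSpread q y) = y := by
  ext c
  simp [spread_apply]

theorem lastSpread_dropLast {k : ℕ} {q : LastLabel k} {x : Fin (k + 1) → ℝ}
    (hx : x ∈ LinearMap.ker (lastForm q)) : lastSpread q (dropLast k x) = x := by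
  ext i
  cases i using Fin.lastCases with
  | last => simp [spread_apply (n := k + 1), mem_ker_lastForm.1 hx]
  | cast c => simp [spread_apply (n := k + 1), dropLast_apply]

theorem lastSpread_mem_ker {k : ℕ} (q : LastLabel k) (y : Fin k → ℝ) :
    lastSpread q y ∈ LinearMap.ker (lastForm q) := by
  rw [mem_ker_lastForm, dropLast_lastSpread]
  simp [spread_apply]

theorem map_dropLast_inf_ker {k : ℕ} (q : LastLabel k) (L : Submodule ℝ (Fin (k + 1) → ℝ)) :
    (L ⊓ LinearMap.ker (lastForm q)).map (dropLast k) = L.comap (lastSpread q) := by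
  ext y
  constructor
  · rintro ⟨x, ⟨hxL, hx⟩, rfl⟩
    rwa [Submodule.mem_comap, lastSpread_dropLast hx]
  · exact fun hy => ⟨_, ⟨hy, lastSpread_mem_ker q y⟩, dropLast_lastSpread q y⟩

theorem lastForm_proportional {k : ℕ} {q q' : LastLabel k} (h : q ≠ q') :
    ∃ m ∈ (· ∘ₗ dropLast k) '' forms k, ∃ c : ℝ, c ≠ 0 ∧
      ∀ x ∈ LinearMap.ker (lastForm q), lastForm q' x = c * m x := by
  have hne : lastIndex q ≠ lastIndex q' ∨
      lastSign q * lastSign q' = -1 ∧ lastIndex q ≠ Fin.last k := by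
    rcases q with _ | ⟨i, t⟩ <;> rcases q' with _ | ⟨j, u⟩
    · exact (h rfl).elim
    · exact Or.inl (Fin.castSucc_ne_last j).symm
    · exact Or.inl (Fin.castSucc_ne_last i)
    · rcases eq_or_ne i j with rfl | hij
      · have htu : t = -u := Int.units_ne_iff_eq_neg.1 fun htu => h (by rw [htu])
        exact Or.inr ⟨by simp [lastSign, htu, Int.units_mul_self], Fin.castSucc_ne_last i⟩
      · exact Or.inl ((Fin.castSucc_injective k).ne hij)
  obtain ⟨m, hm, c, hc, hcm⟩ := exists_rootForm_eq_smul hne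
  obtain ⟨u, hu⟩ := exists_lastForm_apply_eq q'
  refine ⟨_, Set.mem_image_of_mem _ hm, ((u * lastSign q : ℤˣ) : ℤ) * c,
    mul_ne_zero (Int.cast_ne_zero.2 (Units.ne_zero _)) hc, fun x hx => ?_⟩
  have hcmx := LinearMap.congr_fun hcm (dropLast k x)
  rw [LinearMap.smul_apply, smul_eq_mul, rootForm_apply] at hcmx
  rw [hu, mem_ker_lastForm.1 hx, LinearMap.comp_apply, mul_assoc, ← hcmx, ← zsmul_eq_mul,
    ← Units.smul_def, mul_smul, smul_sub (lastSign q), smul_smul (lastSign q), ← mul_assoc,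
    Int.units_mul_self, one_mul]

theorem rootForm_comp_dropLast {k : ℕ} (t : ℤˣ) (o o' : Fin (k + 1)) :
    rootForm t o o' ∘ₗ dropLast k =
      rootForm t (extendLast (Fin.castSucc ∘ Fin.castSucc) o)
        (extendLast (Fin.castSucc ∘ Fin.castSucc) o') := by
  have hone (o : Fin (k + 1)) : extendOne 1 o = 1 := by
    cases o using Fin.lastCases <;> simp
  refine LinearMap.ext fun x => ?_
  rw [LinearMap.comp_apply, rootForm_spread, hone, hone, one_mul, mul_one, one_smul]

theorem forms_succ (k : ℕ) :
    forms (k + 1) =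
      (· ∘ₗ dropLast k) '' forms k ∪ lastForm '' (Finset.univ : Finset (LastLabel k)) := by
  rw [Finset.coe_univ, Set.image_univ]
  refine Set.Subset.antisymm ?_ (Set.union_subset ?_ ?_)
  · rintro _ ⟨t, o, o', h, rfl⟩
    obtain ⟨i, rfl⟩ := Fin.exists_castSucc_eq.2 (Fin.ne_last_of_lt h)
    cases i using Fin.lastCases with
    | last =>
      obtain rfl : o' = Fin.last (k + 1) := by
        rwa [Fin.castSucc_lt_iff_succ_le, Fin.succ_last, Fin.last_le_iff] at h
      exact Or.inr ⟨none, by simp [lastForm, rootForm]⟩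
    | cast i =>
      cases o' using Fin.lastCases with
      | last =>
        refine Or.inl ⟨_, ⟨t, i.castSucc, Fin.last k, Fin.castSucc_lt_last i, rfl⟩, ?_⟩
        simp [rootForm_comp_dropLast]
      | cast j =>
        cases j using Fin.lastCases with
        | last => exact Or.inr ⟨some (i, t), rfl⟩
        | cast j =>
          refine Or.inl ⟨_, ⟨t, i.castSucc, j.castSucc, h, rfl⟩, ?_⟩
          simp [rootForm_comp_dropLast]
  · rintro _ ⟨_, ⟨t, o, o', h, rfl⟩, rfl⟩
    refine ⟨t, _, _, ?_, rootForm_comp_dropLast t o o'⟩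
    obtain ⟨i, rfl⟩ := Fin.exists_castSucc_eq.2 (Fin.ne_last_of_lt h)
    cases o' using Fin.lastCases with
    | last => simp
    | cast j => simpa using h
  · rintro _ ⟨_ | ⟨i, t⟩, rfl⟩
    · exact ⟨1, _, _, Fin.castSucc_lt_last _, rfl⟩
    · exact ⟨t, _, _, Fin.castSucc_lt_castSucc_iff.2 (Fin.castSucc_lt_last i), rfl⟩

theorem InGeneralPosition.not_le_ker {k d : ℕ} {L : Submodule ℝ (Fin k → ℝ)}
    (hL : InGeneralPosition L d) (hbot : L ≠ ⊥) {l : Dual ℝ (Fin k → ℝ)} (hl : l ∈ forms k) :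
    ¬ L ≤ LinearMap.ker l := fun hLl =>
  hbot (hL.eq_bot_of_le (ker_mem_arrangementLattice hl)
    (mt LinearMap.ker_eq_top.1 (ne_zero_of_mem_forms hl)) hLl)

theorem InGeneralPosition.ncard_meetingChambers_succ {k d : ℕ} (hk : 1 ≤ k)
    {L : Submodule ℝ (Fin (k + 1) → ℝ)} (hL : InGeneralPosition L d) :
    (meetingChambers L).ncard = (meetingChambers (L.map (dropLast k))).ncard +
      ∑ q : LastLabel k, (meetingChambers (L.comap (lastSpread q))).ncard := by
  simp only [ncard_meetingChambers]
  by_cases hbot : L = ⊥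
  · have hker (q : LastLabel k) : (⊥ : Submodule ℝ _).comap (lastSpread q) = ⊥ :=
      LinearMap.ker_eq_bot.2 ((isBlockMap_snoc_castSucc _).spread_injective _)
    simp [hbot, hker, regions_bot (forms_nonempty hk),
      regions_bot (forms_nonempty (Nat.le_add_left 1 k))]
  · rw [forms_succ, ncard_regions_union_image ((finite_forms k).image _), ncard_regions_image_comp]
    · simp only [ncard_regions_image_comp, map_dropLast_inf_ker]
    · refine fun q _ => hL.not_le_ker hbot ?_
      rw [forms_succ]
      exact Or.inr ⟨q, Finset.mem_coe.2 (Finset.mem_univ q), rfl⟩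
    · exact fun q _ q' _ => lastForm_proportional

/-! ### The numbers `B(k, j)` and the chambers meeting a subspace -/

theorem B_of_neg {k : ℕ} {j : ℤ} (h : j < 0) : B k j = 0 := if_neg (not_le.2 h)

theorem B_zero (j : ℤ) : B 0 j = if j = 0 then 1 else 0 := by
  rcases lt_trichotomy j 0 with h | rfl | h
  · rw [B_of_neg h, if_neg h.ne]
  · simp [B]
  · rw [B, if_pos h.le, if_neg h.ne', Finset.range_zero, Finset.prod_empty,
      Polynomial.coeff_one, if_neg (by omega)]

theorem B_succ (k : ℕ) (j : ℤ) : B (k + 1) j = B k (j - 1) + (2 * k + 1) * B k j := by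
  rcases lt_trichotomy j 0 with h | rfl | h
  · rw [B_of_neg h, B_of_neg h, B_of_neg (by omega)]
    rfl
  · rw [B_of_neg (by omega : (0 : ℤ) - 1 < 0)]
    simp only [B, le_refl, if_true, Finset.prod_range_succ, Int.toNat_zero, mul_add,
      Polynomial.coeff_add, Polynomial.coeff_mul_X_zero]
    rw [Polynomial.coeff_mul_C, mul_comm]
  · obtain ⟨m, rfl⟩ : ∃ m : ℕ, j = m + 1 := ⟨(j - 1).toNat, by omega⟩
    have e : ((m : ℤ) + 1).toNat = m + 1 := by omega
    rw [add_sub_cancel_right]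
    simp only [B, h.le, if_true, Int.natCast_nonneg, e, Int.toNat_natCast]
    rw [Finset.prod_range_succ, mul_add, Polynomial.coeff_add, Polynomial.coeff_mul_X,
      Polynomial.coeff_mul_C, mul_comm (2 * k + 1)]

/-- The alternating tail `B(k, d - 1) + B(k, d - 3) + ⋯` of the row `B(k, ·)`; the terms with
negative index vanish. -/
def alternateSum (k d : ℕ) : ℕ := ∑ r ∈ Finset.range d, B k ((d : ℤ) - 1 - 2 * (r : ℤ))

theorem alternateSum_add_two (k d : ℕ) :
    alternateSum k (d + 2) = alternateSum k d + B k (d + 1) := by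
  rw [alternateSum, Finset.sum_range_succ', Finset.sum_range_succ, alternateSum,
    B_of_neg (by push_cast; omega), add_zero]
  push_cast
  ring_nf

theorem alternateSum_zero_left (d : ℕ) : alternateSum 0 d + alternateSum 0 (d + 1) = 1 := by
  induction d with
  | zero => simp [alternateSum, B_zero]
  | succ d ih =>
    rw [alternateSum_add_two, B_zero, if_neg (by omega)]
    omega

theorem alternateSum_succ_succ (k d : ℕ) : alternateSum (k + 1) (d + 1) =
    alternateSum k d + (2 * k + 1) * alternateSum k (d + 1) := by
  simp only [alternateSum, B_succ, Finset.sum_add_distrib, ← Finset.mul_sum]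
  rw [Finset.sum_range_succ, B_of_neg (by push_cast; omega), add_zero]
  push_cast
  ring_nf

theorem card_chambers (k : ℕ) :
    Nat.card ((Fin k → ℤˣ) × Equiv.Perm (Fin k)) = 2 ^ k * k.factorial := by
  simp [Fintype.card_perm]

theorem InGeneralPosition.ncard_meetingChambers_zero {k : ℕ} {L : Submodule ℝ (Fin k → ℝ)}
    (hL : InGeneralPosition L 0) : (meetingChambers L).ncard = 2 ^ k * k.factorial := by
  rw [hL.eq_top, meetingChambers_top, Set.ncard_univ, card_chambers]

theorem InGeneralPosition.ncard_meetingChambers_add {k d : ℕ} (hk : 1 ≤ k)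
    {L : Submodule ℝ (Fin k → ℝ)} (hL : InGeneralPosition L d) :
    (meetingChambers L).ncard + 2 * alternateSum k d = 2 ^ k * k.factorial := by
  induction k, hk using Nat.le_induction generalizing d with
  | base =>
    cases d with
    | zero => exact hL.ncard_meetingChambers_zero
    | succ d =>
      have hbot : L = ⊥ := by
        rw [← Submodule.finrank_eq_zero (R := ℝ), hL.finrank_eq]
        omega
      rw [ncard_meetingChambers, hbot, regions_bot (forms_nonempty le_rfl), Set.ncard_empty,
        alternateSum_succ_succ 0 d, mul_zero, zero_add (1 : ℕ), one_mul, alternateSum_zero_left]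
      rfl
  | succ k hk ih =>
    cases d with
    | zero => exact hL.ncard_meetingChambers_zero
    | succ d =>
      have hrestrict := Finset.sum_congr (rfl : (Finset.univ : Finset (LastLabel k)) = _)
        fun q _ => ih (isBlockMap_snoc_castSucc (lastIndex q)
          |>.inGeneralPosition_comap_spread (Fin.snoc (α := fun _ => ℤˣ) 1 (lastSign q)) hL)
      have hcard : (Finset.univ : Finset (LastLabel k)).card = 2 * k + 1 := by simp [mul_comm]
      simp only [Finset.sum_add_distrib, Finset.sum_const, hcard, smul_eq_mul] at hrestrict
      rw [hL.ncard_meetingChambers_succ hk, alternateSum_succ_succ, pow_succ,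
        Nat.factorial_succ]
      linear_combination ih hL.map_dropLast + hrestrict

theorem eventually_pos_add_smul_of_nonneg {E : Type*} [AddCommGroup E] [Module ℝ E]
    {f : Dual ℝ E} {x l κ : E} (hκ : f x = 0 → f κ = 0) (hx : 0 ≤ f x) (hl : 0 < f (l + κ)) :
    ∀ᶠ c : ℝ in 𝓝[>] 0, 0 < f (x + c • l) := by
  rcases hx.eq_or_lt with h0 | h0
  · filter_upwards [self_mem_nhdsWithin] with c hc
    rw [map_add, hκ h0.symm, add_zero] at hl
    rw [map_add, ← h0, zero_add, map_smul]
    exact mul_pos hc hl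
  · exact eventually_pos_add_smul h0 l

theorem InGeneralPosition.mem_meetingChambers {k d : ℕ} {L : Submodule ℝ (Fin k → ℝ)}
    (hL : InGeneralPosition L d) {p : (Fin k → ℤˣ) × Equiv.Perm (Fin k)} {x : Fin k → ℝ}
    (hxL : x ∈ L) (hx : x ∈ chamber p.1 p.2) (hx0 : x ≠ 0) : p ∈ meetingChambers L := by
  -- Write an interior point as `l + κ` with `l ∈ L` and `κ ∈ K`: a small step from `x` in the
  -- direction `l` stays in `L` and enters the interior.
  set K : Submodule ℝ (Fin k → ℝ) := ⨅ H : {H ∈ arrangementLattice k | x ∈ H}, H.1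
  have hK : K ∈ arrangementLattice k := iInf_mem_arrangementLattice fun H => H.2.1
  have hxK : x ∈ K := (Submodule.mem_iInf _).2 fun H => H.2.2
  have hsup : L ⊔ K = ⊤ :=
    hL.sup_eq_top hK ((Submodule.ne_bot_iff _).2 ⟨x, ⟨hxL, hxK⟩, hx0⟩)
  obtain ⟨y, -, hy⟩ : p ∈ meetingChambers ⊤ := by
    rw [meetingChambers_top]
    trivial
  obtain ⟨l, hl, κ, hκ, rfl⟩ := Submodule.mem_sup.1 (hsup ▸ Submodule.mem_top : y ∈ L ⊔ K)
  have hgap (o o' : Fin (k + 1)) (h : o < o') : ∀ᶠ c : ℝ in 𝓝[>] 0,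
      0 < (rootForm 1 o o' ∘ₗ signedPerm p) (x + c • l) := by
    have hflat := comap_spread_mem_arrangementLattice (Fin.castSucc ∘ p.2) p.1
      (ker_rootForm_mem_arrangementLattice 1 o o')
    refine eventually_pos_add_smul_of_nonneg
      (fun h0 => (Submodule.mem_iInf _).1 hκ ⟨_, hflat, h0⟩) ?_ ?_
    · simpa [rootForm_apply] using mem_chamber_iff.1 hx h.le
    · simpa only [LinearMap.comp_apply, rootForm_apply, one_smul, sub_pos] using hy h
  obtain ⟨c, hc⟩ := (eventually_all.2 fun o => eventually_all.2 fun o' =>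
    eventually_imp_distrib_left.2 (hgap o o')).exists
  refine ⟨_, L.add_mem hxL (L.smul_mem c hl), fun o o' h => ?_⟩
  simpa only [LinearMap.comp_apply, rootForm_apply, one_smul, sub_pos] using hc o o' h

theorem InGeneralPosition.ncard_trivial_chambers {k d : ℕ} (hk : 1 ≤ k)
    {L : Submodule ℝ (Fin k → ℝ)} (hL : InGeneralPosition L d) :
    {p : (Fin k → ℤˣ) × Equiv.Perm (Fin k) | ∀ x ∈ L, x ∈ chamber p.1 p.2 → x = 0}.ncard =
      2 * alternateSum k d := by
  have hcompl : {p : (Fin k → ℤˣ) × Equiv.Perm (Fin k) |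
      ∀ x ∈ L, x ∈ chamber p.1 p.2 → x = 0} = (meetingChambers L)ᶜ := by
    ext p
    constructor
    · rintro hp ⟨x, hxL, hx⟩
      rw [hp x hxL (mem_chamber_iff.2 hx.antitone)] at hx
      simpa using hx (Fin.castSucc_lt_last ⟨0, hk⟩)
    · intro hp x hxL hx
      by_contra hx0
      exact hp (hL.mem_meetingChambers hxL hx hx0)
  have hadd := Set.ncard_add_ncard_compl (meetingChambers L)
  rw [card_chambers, ← hL.ncard_meetingChambers_add hk, add_right_inj] at hadd
  rw [hcompl, hadd]

/-! ### Faces of a Weyl chamber -/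

section SimplicialCone

variable {R V ι : Type*} [Field R] [LinearOrder R] [IsStrictOrderedRing R] [AddCommGroup V]
  [Module R V] (b : Basis ι R V)

theorem mem_hull_image_basis {I : Set ι} {x : V} :
    x ∈ PointedCone.hull R (b '' I) ↔
      (∀ i, 0 ≤ b.repr x i) ∧ ∀ i ∉ I, b.repr x i = 0 := by
  classical
  constructor
  · intro hx
    induction hx using Submodule.span_induction with
    | mem x hx =>
      obtain ⟨i, hi, rfl⟩ := hx
      refine ⟨fun j => ?_, fun j hj => ?_⟩
      · rw [b.repr_self_apply]
        split_ifs <;> simp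
      · rw [b.repr_self_apply, if_neg (ne_of_mem_of_not_mem hi hj)]
    | zero => simp
    | add x y _ _ hx hy =>
      exact ⟨fun i => by simpa using add_nonneg (hx.1 i) (hy.1 i),
        fun i hi => by simp [hx.2 i hi, hy.2 i hi]⟩
    | smul c x _ hx =>
      rw [show c • x = (c : R) • x from rfl, map_smul]
      exact ⟨fun i => mul_nonneg c.2 (hx.1 i), fun i hi => by simp [hx.2 i hi]⟩
  · rintro ⟨h0, hI⟩
    rw [← b.linearCombination_repr x, Finsupp.linearCombination_apply]
    refine Submodule.sum_mem _ fun i hi => PointedCone.smul_mem _ (h0 i) ?_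
    exact PointedCone.subset_hull (Set.mem_image_of_mem b
      (by_contra fun h => Finsupp.mem_support_iff.1 hi (hI i h)))

theorem mem_hull_range_basis {x : V} :
    x ∈ PointedCone.hull R (Set.range b) ↔ ∀ i, 0 ≤ b.repr x i := by
  rw [← Set.image_univ, mem_hull_image_basis]
  simp

theorem isFaceOf_hull_image_basis (I : Set ι) :
    (PointedCone.hull R (b '' I)).IsFaceOf (PointedCone.hull R (Set.range b)) where
  le := Submodule.span_mono (Set.image_subset_range b I)
  mem_of_smul_add_mem {x y a} hx hy ha h := by
    rw [mem_hull_range_basis] at hx hy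
    refine (mem_hull_image_basis b).2 ⟨hx, fun i hi => ?_⟩
    have h0 : a * b.repr x i + b.repr y i = 0 := by
      simpa using ((mem_hull_image_basis b).1 h).2 i hi
    have hle : a * b.repr x i ≤ 0 := by linarith [hy i]
    exact le_antisymm (nonpos_of_mul_nonpos_right hle ha) (hx i)

theorem eq_hull_image_basis_of_isFaceOf [Finite ι] {F : PointedCone R V}
    (hF : F.IsFaceOf (PointedCone.hull R (Set.range b))) :
    F = PointedCone.hull R (b '' {i | b i ∈ F}) := by
  cases nonempty_fintype ι
  refine le_antisymm (fun x hx => ?_)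
    (Submodule.span_le.2 (Set.image_subset_iff.2 fun i hi => hi))
  have h0 := (mem_hull_range_basis b).1 (hF.le hx)
  refine (mem_hull_image_basis b).2 ⟨h0, fun i hi => by_contra fun hne => hi ?_⟩
  refine hF.mem_of_sum_smul_mem (fun j => PointedCone.subset_hull (Set.mem_range_self j)) h0 ?_ i
    ((h0 i).lt_of_ne' hne)
  rwa [b.sum_repr]

theorem finrank_span_hull_image_basis (I : Set ι) :
    finrank R (Submodule.span R (PointedCone.hull R (b '' I) : Set V)) = I.ncard := by
  have hli : LinearIndepOn R id (b '' I) :=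
    b.linearIndependent.linearIndepOn_id.mono (Set.image_subset_range b I)
  rw [Submodule.span_span_of_tower, finrank, rank_span_set hli,
    ← Set.ncard_image_of_injective I b.injective]
  rfl

theorem hull_image_basis_injective :
    Function.Injective fun I : Set ι => PointedCone.hull R (b '' I) := by
  have mem_iff (I : Set ι) (i : ι) : b i ∈ PointedCone.hull R (b '' I) ↔ i ∈ I := by
    refine ⟨fun h => by_contra fun hi => one_ne_zero (α := R) ?_,
      fun hi => PointedCone.subset_hull (Set.mem_image_of_mem b hi)⟩
    simpa using ((mem_hull_image_basis b).1 h).2 i hi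
  intro I J h
  ext i
  rw [← mem_iff I, ← mem_iff J, show PointedCone.hull R (b '' I) = _ from h]

end SimplicialCone

/-- The fundamental weights of type `B_n`, up to scaling. -/
def weight {n : ℕ} (i : Fin n) : Fin n → ℝ := fun j => if j ≤ i then 1 else 0

theorem coord_weight {n : ℕ} (o : Fin (n + 1)) (i : Fin n) :
    coord o (weight i) = if o ≤ i.castSucc then 1 else 0 := by
  cases o using Fin.lastCases with
  | last => simp [i.castSucc_lt_last.not_ge]
  | cast j => simp [weight]

theorem rootForm_succ_weight {n : ℕ} (i j : Fin n) :
    rootForm 1 i.castSucc i.succ (weight j) = if i = j then 1 else 0 := by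
  rw [rootForm_apply, one_smul, coord_weight, coord_weight]
  rcases lt_trichotomy i j with h | rfl | h
  · simp [h.le, h.ne, Fin.succ_le_castSucc_iff.2 h]
  · simp
  · simp [h.not_ge, h.ne', Fin.succ_le_castSucc_iff, h.not_gt]

theorem eq_zero_of_rootForm_succ {n : ℕ} {x : Fin n → ℝ}
    (h : ∀ i : Fin n, rootForm 1 i.castSucc i.succ x = 0) : x = 0 := by
  have hle (o : Fin (n + 1)) : coord o x = 0 := by
    induction o using Fin.reverseInduction with
    | last => simp
    | cast i hi => simpa [rootForm_apply, hi] using h i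
  ext i
  simpa using hle i.castSucc

/-- The fundamental weights form the basis dual to the differences of consecutive coordinates. -/
def weightBasis (n : ℕ) : Basis (Fin n) ℝ (Fin n → ℝ) :=
  DualBases.basis (e := weight) (ε := fun i => rootForm 1 i.castSucc i.succ)
    { eval_same := fun i => by simp [rootForm_succ_weight]
      eval_of_ne := fun i j h => by simp [rootForm_succ_weight, h]
      total := fun h => sub_eq_zero.1 (eq_zero_of_rootForm_succ fun i => by
        rw [map_sub, h i, sub_self]) }

@[simp] theorem weightBasis_apply {n : ℕ} (i : Fin n) : weightBasis n i = weight i := by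
  simp [weightBasis]

theorem weightBasis_repr {n : ℕ} (x : Fin n → ℝ) (i : Fin n) :
    (weightBasis n).repr x i = rootForm 1 i.castSucc i.succ x := rfl

/-- The signed permutation inverse to `signedPerm p`, see `signedPerm_inverse`. -/
def inverse {n : ℕ} (p : (Fin n → ℤˣ) × Equiv.Perm (Fin n)) :
    (Fin n → ℤˣ) × Equiv.Perm (Fin n) :=
  (p.1 ∘ p.2.symm, p.2.symm)

theorem inverse_involutive (n : ℕ) : Function.Involutive (inverse (n := n)) := fun p =>
  Prod.ext (funext fun i => by simp [inverse]) rfl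

theorem signedPerm_inverse {n : ℕ} (p : (Fin n → ℤˣ) × Equiv.Perm (Fin n)) (x : Fin n → ℝ) :
    signedPerm (inverse p) (signedPerm p x) = x :=
  spread_leftInverse p.1 (fun c => by simp [inverse]) x

/-- `signedPerm p` as a linear automorphism. -/
def signedPermEquiv {n : ℕ} (p : (Fin n → ℤˣ) × Equiv.Perm (Fin n)) :
    (Fin n → ℝ) ≃ₗ[ℝ] (Fin n → ℝ) :=
  LinearEquiv.ofLinearMap (signedPerm p) (signedPerm (inverse p))
    (LinearMap.ext fun x => by
      simpa [inverse_involutive n p] using signedPerm_inverse (inverse p) x)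
    (LinearMap.ext (signedPerm_inverse p))

/-- The basis of the generators of the extreme rays of a Weyl chamber. -/
def chamberBasis {n : ℕ} (p : (Fin n → ℤˣ) × Equiv.Perm (Fin n)) :
    Basis (Fin n) ℝ (Fin n → ℝ) :=
  (weightBasis n).map (signedPermEquiv p).symm

theorem chamberBasis_apply {n : ℕ} (p : (Fin n → ℤˣ) × Equiv.Perm (Fin n)) (i : Fin n) :
    chamberBasis p i = signedPerm (inverse p) (weight i) := by
  rw [chamberBasis, Basis.map_apply, weightBasis_apply]
  rfl

theorem chamber_eq_hull {n : ℕ} (p : (Fin n → ℤˣ) × Equiv.Perm (Fin n)) :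
    chamber p.1 p.2 = PointedCone.hull ℝ (Set.range (chamberBasis p)) := by
  ext x
  have hrepr (i : Fin n) : (chamberBasis p).repr x i =
      coord i.castSucc (signedPerm p x) - coord i.succ (signedPerm p x) := by
    rw [chamberBasis, Basis.map_repr, LinearEquiv.trans_apply, weightBasis_repr, rootForm_apply,
      one_smul]
    rfl
  simp only [mem_chamber_iff, mem_hull_range_basis, hrepr, sub_nonneg, Fin.antitone_iff_succ_le]

theorem faces_chamber {n : ℕ} (k : ℕ) (p : (Fin n → ℤˣ) × Equiv.Perm (Fin n)) :
    faces k (chamber p.1 p.2) =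
      Set.range fun r : Fin k ↪o Fin n => PointedCone.hull ℝ (chamberBasis p '' Set.range r) := by
  classical
  rw [faces, chamber_eq_hull]
  ext F
  constructor
  · rintro ⟨hF, hk⟩
    rw [eq_hull_image_basis_of_isFaceOf _ hF] at hk ⊢
    rw [finrank_span_hull_image_basis, Set.ncard_eq_toFinset_card'] at hk
    refine ⟨Finset.orderEmbOfFin _ hk, ?_⟩
    dsimp only
    rw [Finset.range_orderEmbOfFin, Set.coe_toFinset]
  · rintro ⟨r, rfl⟩
    refine ⟨isFaceOf_hull_image_basis _ _, ?_⟩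
    rw [finrank_span_hull_image_basis, Set.ncard_range_of_injective r.injective, Nat.card_fin]

/-- The monotone index map `a` with `a j ≤ c ↔ j ≤ r c`: it sends the entries up to `r 0` to `0`,
those after `r 0` up to `r 1` to `1`, and so on, and the remaining ones to `Fin.last k`. -/
def blockMap {k n : ℕ} (r : Fin k ↪o Fin n) (j : Fin n) : Fin (k + 1) :=
  (Finset.univ.filter fun c => r c < j).sup Fin.succ

theorem blockMap_le_castSucc {k n : ℕ} {r : Fin k ↪o Fin n} {j : Fin n} {c : Fin k} :
    blockMap r j ≤ c.castSucc ↔ j ≤ r c := by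
  simp only [blockMap, Finset.sup_le_iff, Finset.mem_filter, Finset.mem_univ, true_and,
    Fin.succ_le_castSucc_iff]
  refine ⟨fun h => le_of_not_gt fun hc => lt_irrefl c (h c hc), fun h c' hc' => ?_⟩
  exact r.lt_iff_lt.1 (hc'.trans_le h)

theorem le_of_castSucc_le_imp {k : ℕ} {o o' : Fin (k + 1)}
    (h : ∀ c : Fin k, o' ≤ c.castSucc → o ≤ c.castSucc) : o ≤ o' := by
  cases o' using Fin.lastCases with
  | last => exact Fin.le_last o
  | cast c => exact h c le_rfl

theorem blockMap_monotone {k n : ℕ} (r : Fin k ↪o Fin n) : Monotone (blockMap r) :=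
  fun _ _ hij => le_of_castSucc_le_imp fun _ h =>
    blockMap_le_castSucc.2 (hij.trans (blockMap_le_castSucc.1 h))

theorem blockMap_apply_self {k n : ℕ} (r : Fin k ↪o Fin n) (c : Fin k) :
    blockMap r (r c) = c.castSucc :=
  (blockMap_le_castSucc.2 le_rfl).antisymm <| le_of_castSucc_le_imp fun _ h =>
    Fin.castSucc_le_castSucc_iff.2 (r.le_iff_le.1 (blockMap_le_castSucc.1 h))

theorem isBlockMap_blockMap {k n : ℕ} (r : Fin k ↪o Fin n) : IsBlockMap (blockMap r) :=
  fun c => ⟨r c, blockMap_apply_self r c⟩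

theorem blockMap_injective {k n : ℕ} : Function.Injective (blockMap (k := k) (n := n)) := by
  intro r r' h
  ext1 c
  refine le_antisymm (blockMap_le_castSucc.1 ?_) (blockMap_le_castSucc.1 ?_)
  · rw [← h, blockMap_apply_self]
  · rw [h, blockMap_apply_self]

theorem exists_blockMap_eq {k n : ℕ} {a : Fin n → Fin (k + 1)} (ha : IsBlockMap a)
    (hmono : Monotone a) : ∃ r, blockMap r = a := by
  have hex (c : Fin k) : ∃ m, ∀ j, a j ≤ c.castSucc ↔ j ≤ m := by
    obtain ⟨i, hi⟩ := ha c
    have hne : (Finset.univ.filter fun j => a j ≤ c.castSucc).Nonempty := ⟨i, by simp [hi]⟩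
    refine ⟨Finset.max' _ hne, fun j => ⟨fun h => Finset.le_max' _ _ (by simpa using h),
      fun h => (hmono h).trans ?_⟩⟩
    simpa using Finset.max'_mem _ hne
  choose m hm using hex
  have hstrict : StrictMono m := fun c c' hcc' => by
    obtain ⟨i, hi⟩ := ha c'
    have hi' : i ≤ m c' := (hm c' i).1 hi.le
    refine lt_of_lt_of_le (lt_of_not_ge fun h => ?_) hi'
    exact (hi ▸ (hm c i).2 h).not_gt (Fin.castSucc_lt_castSucc_iff.2 hcc')
  have heq (j : Fin n) (c : Fin k) :
      blockMap (OrderEmbedding.ofStrictMono m hstrict) j ≤ c.castSucc ↔ a j ≤ c.castSucc := by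
    rw [blockMap_le_castSucc, hm]
    rfl
  exact ⟨_, funext fun j => (le_of_castSucc_le_imp fun c => (heq j c).2).antisymm
    (le_of_castSucc_le_imp fun c => (heq j c).1)⟩

theorem spread_blockMap_weight {k n : ℕ} (r : Fin k ↪o Fin n) (c : Fin k) :
    spread (blockMap r) 1 (weight c) = weight (r c) := by
  ext j
  simp [spread_apply, coord_weight, blockMap_le_castSucc, weight]

theorem signedPerm_spread {k n : ℕ} (p : (Fin n → ℤˣ) × Equiv.Perm (Fin n))
    (a : Fin n → Fin (k + 1)) (y : Fin k → ℝ) :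
    signedPerm p (spread a 1 y) = spread (a ∘ p.2) p.1 y := by
  ext i
  simp [spread_apply]

theorem hull_chamberBasis_image_range {k n : ℕ} (p : (Fin n → ℤˣ) × Equiv.Perm (Fin n))
    (r : Fin k ↪o Fin n) :
    PointedCone.hull ℝ (chamberBasis p '' Set.range r) =
      (chamber 1 1).map (spread (blockMap r ∘ (inverse p).2) (inverse p).1) := by
  have hweight (c : Fin k) : chamberBasis (1, 1) c = weight c :=
    (chamberBasis_apply _ c).trans (spread_castSucc_one _)
  rw [show chamber 1 1 = _ from chamber_eq_hull (1, 1), PointedCone.map, Submodule.map_span,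
    ← Set.range_comp, ← Set.range_comp]
  congr 2 with c : 1
  simp only [Function.comp_apply, hweight, chamberBasis_apply p, ← spread_blockMap_weight r,
    signedPerm_spread]
  rfl

/-- The pairs `p` of signs and a permutation for which `spread (a ∘ p.2) p.1` maps no nonzero point
of the fundamental chamber into `L`. For a block map `a` and varying `p`, the images of the
fundamental chamber under these maps are the images of one face under the group of signed
permutations. -/
def trivialPairs {k n : ℕ} (L : Submodule ℝ (Fin n → ℝ)) (a : Fin n → Fin (k + 1)) :
    Set ((Fin n → ℤˣ) × Equiv.Perm (Fin n)) :=
  {p | ∀ y ∈ chamber 1 1, spread (a ∘ p.2) p.1 y ∈ L → y = 0}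

theorem IsBlockMap.comp_perm {k n : ℕ} {a : Fin n → Fin (k + 1)} (ha : IsBlockMap a)
    (σ : Equiv.Perm (Fin n)) : IsBlockMap (a ∘ σ) := fun c => by
  obtain ⟨i, hi⟩ := ha c
  exact ⟨σ.symm i, by simpa using hi⟩

theorem coe_map_inter_eq_zero_iff {R V W : Type*} [Semiring R] [PartialOrder R] [IsOrderedRing R]
    [AddCommMonoid V] [Module R V] [AddCommMonoid W] [Module R W] {f : V →ₗ[R] W}
    (hf : Function.Injective f) (C : PointedCone R V) (L : Submodule R W) :
    (C.map f : Set W) ∩ (L : Set W) = {0} ↔ ∀ y ∈ C, f y ∈ L → y = 0 := by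
  constructor
  · intro h y hy hyL
    have hmem : f y ∈ (C.map f : Set W) ∩ (L : Set W) := ⟨PointedCone.mem_map.2 ⟨y, hy, rfl⟩, hyL⟩
    rw [h] at hmem
    exact (map_eq_zero_iff f hf).1 hmem
  · refine fun h => Set.Subset.antisymm ?_
      (Set.singleton_subset_iff.2 ⟨Submodule.zero_mem _, L.zero_mem⟩)
    rintro x ⟨hx, hxL⟩
    obtain ⟨y, hy, rfl⟩ := PointedCone.mem_map.1 hx
    rw [Set.mem_singleton_iff, h y hy hxL, map_zero]

theorem numTrivialFaces_chamber {n : ℕ} (k : ℕ) (L : Submodule ℝ (Fin n → ℝ))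
    (p : (Fin n → ℤˣ) × Equiv.Perm (Fin n)) :
    numTrivialFaces k L (chamber p.1 p.2) =
      {r : Fin k ↪o Fin n | inverse p ∈ trivialPairs L (blockMap r)}.ncard := by
  have hinj : Function.Injective fun r : Fin k ↪o Fin n =>
      PointedCone.hull ℝ (chamberBasis p '' Set.range r) := fun r r' h =>
    OrderEmbedding.range_inj.1 (hull_image_basis_injective _ h)
  rw [numTrivialFaces, faces_chamber, Set.ofPred_and, Set.ofPred_mem_eq,
    ← Set.image_preimage_eq_range_inter, Set.ncard_image_of_injective _ hinj]
  congr 1 with r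
  rw [Set.mem_preimage, Set.mem_ofPred_eq, hull_chamberBasis_image_range,
    coe_map_inter_eq_zero_iff (((isBlockMap_blockMap r).comp_perm _).spread_injective _)]
  rfl

/-! ### Averaging over the signed permutations -/

theorem sum_ncard_comm {α β : Type*} [Fintype α] [Fintype β] (R : α → β → Prop) :
    ∑ a, {b | R a b}.ncard = ∑ b, {a | R a b}.ncard := by
  classical
  simp_rw [Set.ncard_eq_toFinset_card', Set.toFinset_ofPred]
  exact Finset.sum_card_bipartiteAbove_eq_sum_card_bipartiteBelow R

theorem ncard_preimage_of_bijective {α β : Type*} {f : α → β} (hf : Function.Bijective f)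
    (s : Set β) : (f ⁻¹' s).ncard = s.ncard :=
  Set.ncard_preimage_of_injective_subset_range hf.1 (by simp [hf.2.range_eq])

theorem sum_numTrivialFaces {n : ℕ} (k : ℕ) (L : Submodule ℝ (Fin n → ℝ)) :
    ∑ p : (Fin n → ℤˣ) × Equiv.Perm (Fin n), numTrivialFaces k L (chamber p.1 p.2) =
      ∑ r : Fin k ↪o Fin n, (trivialPairs L (blockMap r)).ncard := by
  simp_rw [numTrivialFaces_chamber]
  rw [sum_ncard_comm]
  exact Finset.sum_congr rfl fun r _ =>
    ncard_preimage_of_bijective (inverse_involutive n).bijective _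

theorem ncard_trivialPairs_comp_perm {k n : ℕ} (L : Submodule ℝ (Fin n → ℝ))
    (a : Fin n → Fin (k + 1)) (π : Equiv.Perm (Fin n)) :
    (trivialPairs L (a ∘ π)).ncard = (trivialPairs L a).ncard :=
  ncard_preimage_of_bijective
    (Function.bijective_id.prodMap (Equiv.mulLeft π).bijective) (trivialPairs L a)

theorem mem_chamber_iff_signedPerm_mem {k : ℕ} {q : (Fin k → ℤˣ) × Equiv.Perm (Fin k)}
    {x : Fin k → ℝ} : x ∈ chamber q.1 q.2 ↔ signedPerm q x ∈ chamber 1 1 := by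
  rw [mem_chamber_iff, show signedPerm q x ∈ chamber 1 1 ↔ _ from mem_chamber_iff (p := (1, 1)),
    show signedPerm (1, 1) (signedPerm q x) = _ from spread_castSucc_one _]

/-- Moving the fundamental chamber by a signed permutation relabels the blocks of `a` and changes
the signs. -/
theorem ncard_trivialPairs_relabel {k n : ℕ} (L : Submodule ℝ (Fin n → ℝ))
    (a : Fin n → Fin (k + 1)) (q : (Fin k → ℤˣ) × Equiv.Perm (Fin k)) :
    {p : (Fin n → ℤˣ) × Equiv.Perm (Fin n) |
        ∀ y ∈ chamber q.1 q.2, spread (a ∘ p.2) p.1 y ∈ L → y = 0}.ncard =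
      (trivialPairs L (extendLast (Fin.castSucc ∘ q.2.symm) ∘ a)).ncard := by
  let f (p : (Fin n → ℤˣ) × Equiv.Perm (Fin n)) : (Fin n → ℤˣ) × Equiv.Perm (Fin n) :=
    (fun i => p.1 i * extendOne (inverse q).1 (a (p.2 i)), p.2)
  have hf : Function.Involutive f := fun p =>
    Prod.ext (funext fun i => by simp [f, mul_assoc, Int.units_mul_self]) rfl
  rw [← ncard_preimage_of_bijective hf.bijective (trivialPairs L _)]
  congr 1 with p
  have hspread (y : Fin k → ℝ) :
      spread (extendLast (Fin.castSucc ∘ q.2.symm) ∘ a ∘ p.2) (f p).1 (signedPerm q y) =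
        spread (a ∘ p.2) p.1 y := by
    have h := spread_spread (a ∘ p.2) p.1 (Fin.castSucc ∘ (inverse q).2) (inverse q).1
      (signedPerm q y)
    rwa [show spread (Fin.castSucc ∘ (inverse q).2) (inverse q).1 (signedPerm q y) = y from
      signedPerm_inverse q y, eq_comm] at h
  have hzero (y : Fin k → ℝ) : signedPerm q y = 0 ↔ y = 0 :=
    map_eq_zero_iff (signedPermEquiv q) (signedPermEquiv q).injective
  refine Iff.trans ?_ (signedPermEquiv q).surjective.forall.symm
  refine forall_congr' fun y => ?_
  rw [mem_chamber_iff_signedPerm_mem, ← hspread, ← hzero]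
  rfl

theorem exists_blockMap_eq_comp {k n : ℕ} {a : Fin n → Fin (k + 1)} (ha : IsBlockMap a) :
    ∃ (r : Fin k ↪o Fin n) (π : Equiv.Perm (Fin n)), blockMap r = a ∘ π := by
  obtain ⟨r, hr⟩ := exists_blockMap_eq (ha.comp_perm (Tuple.sort a)) (Tuple.monotone_sort a)
  exact ⟨r, _, hr⟩

theorem IsBlockMap.relabel {k n : ℕ} {a : Fin n → Fin (k + 1)} (ha : IsBlockMap a)
    (τ : Equiv.Perm (Fin k)) : IsBlockMap (extendLast (Fin.castSucc ∘ τ) ∘ a) := fun c => by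
  obtain ⟨i, hi⟩ := ha (τ.symm c)
  exact ⟨i, by simp [hi]⟩

theorem sum_ncard_trivialPairs_relabel {k n : ℕ} (L : Submodule ℝ (Fin n → ℝ))
    (τ : Equiv.Perm (Fin k)) :
    ∑ r : Fin k ↪o Fin n,
        (trivialPairs L (extendLast (Fin.castSucc ∘ τ) ∘ blockMap r)).ncard =
      ∑ r : Fin k ↪o Fin n, (trivialPairs L (blockMap r)).ncard := by
  choose f π hf using fun r : Fin k ↪o Fin n =>
    exists_blockMap_eq_comp ((isBlockMap_blockMap r).relabel τ)
  have hinj : Function.Injective f := fun r r' h => by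
    have hcomp : blockMap r ∘ π r = blockMap r' ∘ π r' :=
      (extendLast_perm_bijective τ).1.comp_left ((hf r).symm.trans (h ▸ hf r'))
    have hperm : blockMap r = blockMap r' ∘ (π r' * (π r)⁻¹) := by
      ext1 i
      simpa using congrFun hcomp ((π r)⁻¹ i)
    refine blockMap_injective (hperm.trans ?_)
    exact Tuple.unique_monotone (τ := 1) (hperm ▸ blockMap_monotone r) (blockMap_monotone r')
  refine Fintype.sum_bijective f (Finite.injective_iff_bijective.1 hinj) _ _ fun r => ?_
  rw [hf, ncard_trivialPairs_comp_perm]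

theorem card_mul_sum_ncard_trivialPairs {n k d : ℕ} (hk : 1 ≤ k) {L : Submodule ℝ (Fin n → ℝ)}
    (hL : InGeneralPosition L d) :
    (2 ^ k * k.factorial) * ∑ r : Fin k ↪o Fin n, (trivialPairs L (blockMap r)).ncard =
      (2 ^ n * n.factorial) * n.choose k * (2 * alternateSum k d) := by
  let Trivial (r : Fin k ↪o Fin n) (q : (Fin k → ℤˣ) × Equiv.Perm (Fin k))
      (p : (Fin n → ℤˣ) × Equiv.Perm (Fin n)) : Prop :=
    ∀ y ∈ chamber q.1 q.2, spread (blockMap r ∘ p.2) p.1 y ∈ L → y = 0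
  have hq (q) : ∑ r, {p | Trivial r q p}.ncard =
      ∑ r : Fin k ↪o Fin n, (trivialPairs L (blockMap r)).ncard := by
    simp_rw [Trivial, ncard_trivialPairs_relabel]
    exact sum_ncard_trivialPairs_relabel L q.2.symm
  have hp (r p) : {q | Trivial r q p}.ncard = 2 * alternateSum k d := by
    have h := InGeneralPosition.ncard_trivial_chambers hk
      (((isBlockMap_blockMap r).comp_perm p.2).inGeneralPosition_comap_spread p.1 hL)
    rw [← h]
    congr 1 with q
    exact forall_congr' fun y => forall_comm
  calc _ = ∑ q, ∑ r, {p | Trivial r q p}.ncard := by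
        simp_rw [hq]
        rw [Finset.sum_const, Finset.card_univ, ← Nat.card_eq_fintype_card, card_chambers,
          smul_eq_mul]
    _ = ∑ r, ∑ p, {q | Trivial r q p}.ncard := by
        rw [Finset.sum_comm]
        exact Finset.sum_congr rfl fun r _ => sum_ncard_comm _
    _ = _ := by
        simp_rw [hp, Finset.sum_const, Finset.card_univ, ← Nat.card_eq_fintype_card,
          Nat.card_congr Set.powersetCard.ofFinEmbEquiv, Set.powersetCard.card, card_chambers,
          Nat.card_fin, smul_eq_mul]
        ring

end WeylB

end

/-- In `∑ r, B(k, d - 1 - 2r)` all the terms with `r ≥ d` have a negative second index, hence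
vanish, so the range of summation `r < d` is no restriction. -/
theorem theorem2p1 (n d k : ℕ) (hk : 1 ≤ k) (hkn : k ≤ n)
    (L : Submodule ℝ (Fin n → ℝ))
    (hcodim : Module.finrank ℝ ((Fin n → ℝ) ⧸ L) = d)
    (hL : WeylB.InGeneralPosition L d) :
    (1 / ((2 : ℝ) ^ n * (n.factorial : ℝ))) *
        ∑ ε : Fin n → ℤˣ, ∑ σ : Equiv.Perm (Fin n),
          (WeylB.numTrivialFaces k L (WeylB.chamber ε σ) : ℝ)
      = 2 * (n.choose k : ℝ) *
          ((∑ r ∈ Finset.range d, WeylB.B k ((d : ℤ) - 1 - 2 * (r : ℤ)) : ℕ) : ℝ)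
          / ((2 : ℝ) ^ k * (k.factorial : ℝ)) := by
  have h := congrArg (Nat.cast (R := ℝ)) (WeylB.card_mul_sum_ncard_trivialPairs hk hL)
  rw [← WeylB.sum_numTrivialFaces, Fintype.sum_prod_type, WeylB.alternateSum] at h
  push_cast at h ⊢
  field_simp
  linarith
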